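/- Let $X=(X_s)_{s\ge 0}$ be a subordinator (a process with $X_0=0$, stationary independent increments and almost surely nondecreasing right-continuous paths), with drift $d\ge 0$ and Lévy measure $\Pi$ on $(0,\infty)$, $\int_0^\infty \min\{1,x\}\,\Pi(dx)<\infty$; that is, $$\mathbb{E}\big[e^{-\lambda X_s}\big]=\exp\Big(-s\Big(d\lambda+\int_0^\infty(1-e^{-\lambda y})\,\Pi(dy)\Big)\Big)\qquad\text{for all }\lambda>0,\ s\ge 0 .$$ Assume that $X$ is not a compound Poisson process, that is, either $\Pi(0,\infty)=\infty$, or $\Pi(0,\infty)<\infty$ and $d>0$. For $t>0$ and $\delta>0$ let $N(t,\delta)$ be the minimal number of intervals of length at most $\delta$ needed to cover the range $\{X_s: 0\le s\le t\}$, let $T_1(\delta)=\inf\{s\ge 0: X_s>\delta\}$, and let $U(\delta)=\mathbb{E}[T_1(\delta)]$ be the potential function of $X$. Then $U(\delta)<\infty$ for every $\delta>0$, and for every fixed $t>0$, almost surely, $N(t,\delta)<\infty$ for every $\delta>0$ and $$\lim_{\delta\downarrow 0} U(\delta)\,N(t,\delta)=t .$$ -/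

import Mathlib

open MeasureTheory ProbabilityTheory Filter Topology Set
open scoped NNReal ENNReal

namespace SubordinatorRange

noncomputable section

/-- `X` is a subordinator on `(Ω, P)`: a real process with time set `[0, ∞)`, started at `0`, with
independent and stationary increments, whose paths are almost surely nondecreasing and
right-continuous (left limits then exist by monotonicity). -/
structure IsSubordinator {Ω : Type*} [MeasurableSpace Ω] (X : ℝ≥0 → Ω → ℝ) (P : Measure Ω) :
    Prop where
  measurable : ∀ t, Measurable (X t)
  start : ∀ᵐ ω ∂P, X 0 ω = 0
  indep_increments : HasIndepIncrements X P
  stationary_increments : ∀ s t : ℝ≥0, IdentDistrib (fun ω ↦ X (s + t) ω - X s ω) (X t) P P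
  mono : ∀ᵐ ω ∂P, Monotone fun t ↦ X t ω
  right_continuous : ∀ᵐ ω ∂P, ∀ t, ContinuousWithinAt (fun s ↦ X s ω) (Ici t) t

/-- The Lévy–Khintchine exponent `Φ(l) = d l + ∫_{(0,∞)} (1 - e^{-l y}) Π(dy)`. -/
def levyExponent (d : ℝ) (Pi : Measure ℝ) (l : ℝ) : ℝ :=
  d * l + ∫ y in Ioi (0 : ℝ), (1 - Real.exp (-l * y)) ∂Pi

/-- `d` and `Pi` (a measure of which only the restriction to `(0, ∞)` matters) are the drift and
the Lévy measure of the process `X`: `d ≥ 0`, `∫_{(0,∞)} min(1, y) Π(dy) < ∞`, and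
`E[e^{-l X_t}] = e^{-t Φ(l)}` for all `l > 0` and `t ≥ 0`. -/
structure HasDriftAndLevyMeasure {Ω : Type*} [MeasurableSpace Ω] (X : ℝ≥0 → Ω → ℝ)
    (P : Measure Ω) (d : ℝ) (Pi : Measure ℝ) : Prop where
  drift_nonneg : 0 ≤ d
  lintegral_min_lt_top : ∫⁻ y in Ioi (0 : ℝ), ENNReal.ofReal (min 1 y) ∂Pi < ∞
  laplace : ∀ (t : ℝ≥0) (l : ℝ), 0 < l →
    ∫ ω, Real.exp (-l * X t ω) ∂P = Real.exp (-t * levyExponent d Pi l)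

/-- The first passage time `T₁(δ) = inf {t ≥ 0 : X_t > δ}`, equal to `∞` if there is no such
`t`. -/
def firstPassage {Ω : Type*} (X : ℝ≥0 → Ω → ℝ) (δ : ℝ) (ω : Ω) : ℝ≥0∞ :=
  ⨅ (t : ℝ≥0) (_ : δ < X t ω), (t : ℝ≥0∞)

/-- The potential function `U(δ) = E[T₁(δ)]`. -/
def potential {Ω : Type*} [MeasurableSpace Ω] (X : ℝ≥0 → Ω → ℝ) (P : Measure Ω) (δ : ℝ) :
    ℝ≥0∞ :=
  ∫⁻ ω, firstPassage X δ ω ∂P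

/-- `S` is covered by `n` intervals of length at most `δ`. The intervals are written as closed
ones, since every bounded interval lies in a closed one of the same length. -/
def CoveredBy (S : Set ℝ) (δ : ℝ) (n : ℕ) : Prop :=
  ∃ a b : Fin n → ℝ, (∀ i, a i ≤ b i ∧ b i - a i ≤ δ) ∧ S ⊆ ⋃ i, Icc (a i) (b i)

/-- The minimal number of intervals of length at most `δ` that cover `S` (`∞` if no finite number
suffices). -/
def coverNumber (S : Set ℝ) (δ : ℝ) : ℕ∞ :=
  ⨅ (n : ℕ) (_ : CoveredBy S δ n), (n : ℕ∞)

/-- `N(t, δ)`: the minimal number of intervals of length at most `δ` that cover the range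
`{X_s : 0 ≤ s ≤ t}` of the path of `ω`. -/
def rangeCoverNumber {Ω : Type*} (X : ℝ≥0 → Ω → ℝ) (t : ℝ≥0) (δ : ℝ) (ω : Ω) : ℕ∞ :=
  coverNumber ((fun s ↦ X s ω) '' Iic t) δ

end

end SubordinatorRange

/-! On a grid of mesh h the increments of X form a random walk with nonnegative i.i.d. steps ξ.
Cover its values greedily; after k steps let x be the room left in the current interval and c the
number of intervals used. Let u(x) = ∑ₖ P(X_{kh} ≤ x). The renewal equation u(x) = 1 + E u(x − ξ)
for x ≥ 0, together with u = 0 on the negative half-line, makes c u(δ) − u(x) − k a martingale: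
opening an interval adds u(δ) to both of the first two terms. Its square minus u(x)² is `energy`,
whose mean grows by at most 2u(δ) per step. For m steps with hm = t this yields E(h u(δ) c − t)² ≤
4t h u(δ) + 2(h u(δ))², which is `lintegral_greedy_count_sub_sq_le`.

The greedy covering is optimal (`coverNumber_eq_greedy`), its count on fine dyadic grids equals N(t,
δ) (`eventually_coverNumber_dyadicGrid`), and U(δ) ≤ h u(δ) ≤ U(δ) + h. Fatou's lemma then gives
E(U(δ) N(t, δ) − t)² ≤ 4t U(δ) + 2U(δ)² (`lintegral_sq_error_le`).

Since X is not compound Poisson, its exponent is unbounded, its paths are strictly increasing, and U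
is continuous with U(0) = 0. Hence there are δₙ with U(δₙ) = U(1)/(n + 1)². The mean square errors
along them are summable, so almost surely the limit holds along δₙ. Monotonicity of U and N fills
the gaps, because U(δₙ)/U(δₙ₊₂) → 1 (`tendsto_mul_of_tendsto_subseq`). -/

namespace SubordinatorRange

/-! ### Greedy covering of a random walk -/

/-- One step of the greedy covering of a nondecreasing sequence by intervals of length `δ`. The
state is the room left in the current interval together with the number of intervals used. -/
noncomputable def greedyStep (δ : ℝ) (s : ℝ × ℕ) (y : ℝ) : ℝ × ℕ :=
  if y ≤ s.1 then (s.1 - y, s.2) else (δ, s.2 + 1)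

/-- The state of the greedy covering after the increments `ξ 0, …, ξ (k - 1)`. -/
noncomputable def greedy (δ : ℝ) (ξ : ℕ → ℝ) : ℕ → ℝ × ℕ
  | 0 => (δ, 1)
  | k + 1 => greedyStep δ (greedy δ ξ k) (ξ k)

lemma measurable_greedyStep (δ : ℝ) :
    Measurable fun p : (ℝ × ℕ) × ℝ ↦ greedyStep δ p.1 p.2 := by
  unfold greedyStep
  refine Measurable.ite (measurableSet_le (by fun_prop) (by fun_prop)) ?_ ?_
  · fun_prop
  · exact measurable_const.prodMk
      ((measurable_from_top (f := fun n : ℕ ↦ n + 1)).comp (by fun_prop))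

/-- Factoring through the first k increments is what makes the state independent of the increment
with index k. -/
lemma exists_measurable_greedy_eq (δ : ℝ) (k : ℕ) :
    ∃ f : ((Finset.range k) → ℝ) → ℝ × ℕ, Measurable f ∧
      ∀ ξ : ℕ → ℝ, greedy δ ξ k = f fun i ↦ ξ i := by
  induction k with
  | zero => exact ⟨fun _ ↦ (δ, 1), measurable_const, fun _ ↦ rfl⟩
  | succ k ih =>
    obtain ⟨f, hf, hfe⟩ := ih
    refine ⟨fun v ↦ greedyStep δ
      (f fun i ↦ v ⟨i, Finset.mem_range.2 ((Finset.mem_range.1 i.2).trans (Nat.lt_succ_self k))⟩)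
      (v ⟨k, Finset.self_mem_range_succ k⟩), ?_, fun ξ ↦ ?_⟩
    · refine (measurable_greedyStep δ).comp (Measurable.prodMk (hf.comp ?_) (by fun_prop))
      exact measurable_pi_lambda _ fun i ↦ by fun_prop
    · rw [greedy, hfe]

lemma measurable_greedy {Ω : Type*} [MeasurableSpace Ω] (δ : ℝ) {ξ : ℕ → Ω → ℝ}
    (hξ : ∀ k, Measurable (ξ k)) (k : ℕ) : Measurable fun ω ↦ greedy δ (fun i ↦ ξ i ω) k := by
  induction k with
  | zero => exact measurable_const
  | succ k ih => exact (measurable_greedyStep δ).comp (ih.prodMk (hξ k))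

lemma greedy_room_mem {δ : ℝ} (hδ : 0 ≤ δ) {ξ : ℕ → ℝ} (hξ : ∀ k, 0 ≤ ξ k) (k : ℕ) :
    (greedy δ ξ k).1 ∈ Icc 0 δ := by
  induction k with
  | zero => exact ⟨hδ, le_rfl⟩
  | succ k ih =>
    rw [greedy, greedyStep]
    split_ifs with h
    · exact ⟨sub_nonneg.2 h, by linarith [ih.2, hξ k]⟩
    · exact ⟨hδ, le_rfl⟩

lemma greedy_count_le (δ : ℝ) (ξ : ℕ → ℝ) (k : ℕ) : (greedy δ ξ k).2 ≤ k + 1 := by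
  induction k with
  | zero => exact le_rfl
  | succ k ih =>
    rw [greedy, greedyStep]
    split_ifs <;> simp only <;> omega

lemma indepFun_greedy {Ω : Type*} [MeasurableSpace Ω] {P : Measure Ω} (δ : ℝ) {ξ : ℕ → Ω → ℝ}
    (hξ : ∀ k, Measurable (ξ k)) (hind : iIndepFun ξ P) (k : ℕ) :
    IndepFun (fun ω ↦ greedy δ (fun i ↦ ξ i ω) k) (ξ k) P := by
  obtain ⟨f, hf, hfe⟩ := exists_measurable_greedy_eq δ k
  have h := hind.indepFun_finset (Finset.range k) {k} (by simp) hξ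
  have hev : Measurable fun v : ({k} : Finset ℕ) → ℝ ↦ v ⟨k, Finset.mem_singleton_self k⟩ :=
    measurable_pi_apply _
  have h2 := h.comp hf hev
  simp_rw [hfe]
  exact h2

/-! ### Second moment of the greedy count -/

/-- The function whose integral along the greedy covering grows at a bounded rate. -/
noncomputable def energy (u : ℝ → ℝ) (δ : ℝ) (k : ℕ) (s : ℝ × ℕ) : ℝ :=
  (s.2 * u δ - u s.1 - k) ^ 2 - u s.1 ^ 2

/-- The square subtracted in `energy` cancels the square of u at the new room, leaving an expression
affine in `u (s.1 - y)`, whose mean the renewal equation gives. Equality holds unless a new interval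
opens; then `u (s.1 - y)` vanishes and the left side is smaller by `u δ ^ 2`. -/
lemma energy_greedyStep_le {u : ℝ → ℝ} (hu0 : ∀ x < 0, u x = 0) (δ : ℝ)
    (k : ℕ) (s : ℝ × ℕ) (y : ℝ) :
    energy u δ (k + 1) (greedyStep δ s y) ≤
      (s.2 * u δ - (k + 1)) ^ 2 - 2 * (s.2 * u δ - (k + 1)) * u (s.1 - y) := by
  rw [greedyStep, energy]
  split_ifs with h
  · push_cast
    nlinarith
  · rw [hu0 (s.1 - y) (by linarith)]
    push_cast
    nlinarith [sq_nonneg (u δ)]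

section SecondMoment

variable {Ω : Type*} [MeasurableSpace Ω] {P : Measure Ω} [IsProbabilityMeasure P]
  {ξ : ℕ → Ω → ℝ} {μ : Measure ℝ} {u : ℝ → ℝ} {δ : ℝ}

lemma integrable_energy_greedy (hξ : ∀ k, Measurable (ξ k)) (hpos : ∀ k, ∀ᵐ ω ∂P, 0 ≤ ξ k ω)
    (humono : Monotone u) (hunn : ∀ x, 0 ≤ u x) (hδ : 0 ≤ δ) (k : ℕ) :
    Integrable (fun ω ↦ energy u δ k (greedy δ (fun i ↦ ξ i ω) k)) P := by
  have hm := measurable_greedy δ hξ k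
  have hum := humono.measurable
  refine Integrable.of_bound (C := (((k + 1 : ℕ) : ℝ) * u δ + u δ + k) ^ 2 + u δ ^ 2) ?_ ?_
  · unfold energy
    have h1 : Measurable fun ω ↦ ((greedy δ (fun i ↦ ξ i ω) k).2 : ℝ) :=
      (measurable_from_top (f := fun n : ℕ ↦ (n : ℝ))).comp hm.snd
    have h2 : Measurable fun ω ↦ u (greedy δ (fun i ↦ ξ i ω) k).1 := hum.comp hm.fst
    exact ((((h1.mul_const _).sub h2).sub_const _).pow_const 2 |>.sub
      (h2.pow_const 2)).aestronglyMeasurable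
  · filter_upwards [ae_all_iff.2 hpos] with ω hω
    have hx := greedy_room_mem hδ hω k
    have hn : ((greedy δ (fun i ↦ ξ i ω) k).2 : ℝ) ≤ ((k + 1 : ℕ) : ℝ) :=
      Nat.cast_le.2 (greedy_count_le _ _ _)
    have h1 := humono hx.2
    have h2 := hunn (greedy δ (fun i ↦ ξ i ω) k).1
    have h3 := mul_le_mul_of_nonneg_right hn (hunn δ)
    have h4 : 0 ≤ ((greedy δ (fun i ↦ ξ i ω) k).2 : ℝ) * u δ := by have := hunn δ; positivity
    have h5 : (0 : ℝ) ≤ k := k.cast_nonneg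
    rw [energy, Real.norm_eq_abs]
    refine (abs_sub _ _).trans (add_le_add ?_ ?_)
    · rw [abs_of_nonneg (sq_nonneg _)]
      refine sq_le_sq' ?_ ?_ <;> nlinarith
    · rw [abs_of_nonneg (sq_nonneg _)]
      exact pow_le_pow_left₀ h2 h1 2

lemma integral_energy_greedy_succ_le (hξ : ∀ k, Measurable (ξ k))
    (hpos : ∀ k, ∀ᵐ ω ∂P, 0 ≤ ξ k ω) (hind : iIndepFun ξ P) (hlaw : ∀ k, P.map (ξ k) = μ)
    (humono : Monotone u) (hunn : ∀ x, 0 ≤ u x) (hu0 : ∀ x < 0, u x = 0)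
    (hren : ∀ x, 0 ≤ x → u x = 1 + ∫ y, u (x - y) ∂μ) (hδ : 0 ≤ δ) (k : ℕ) :
    ∫ ω, energy u δ (k + 1) (greedy δ (fun i ↦ ξ i ω) (k + 1)) ∂P ≤
      ∫ ω, energy u δ k (greedy δ (fun i ↦ ξ i ω) k) ∂P + 2 * u δ := by
  have hm := measurable_greedy δ hξ k
  have hum := humono.measurable
  have hμ : IsProbabilityMeasure μ :=
    hlaw 0 ▸ Measure.isProbabilityMeasure_map (hξ 0).aemeasurable
  set s : Ω → ℝ × ℕ := fun ω ↦ greedy δ (fun i ↦ ξ i ω) k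
  let A : ℝ × ℕ → ℝ := fun s ↦ s.2 * u δ - (k + 1)
  have hA : Measurable A := by
    have h1 : Measurable fun s : ℝ × ℕ ↦ (s.2 : ℝ) :=
      (measurable_from_top (f := fun n : ℕ ↦ (n : ℝ))).comp measurable_snd
    exact (h1.mul_const _).sub_const _
  have hbA : ∀ ω, |A (s ω)| ≤ ((k + 1 : ℕ) : ℝ) * u δ + (k + 1) := fun ω ↦ by
    have hn : ((s ω).2 : ℝ) ≤ ((k + 1 : ℕ) : ℝ) := Nat.cast_le.2 (greedy_count_le _ _ _)
    have h3 := mul_le_mul_of_nonneg_right hn (hunn δ)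
    have h4 : 0 ≤ ((s ω).2 : ℝ) * u δ := by have := hunn δ; positivity
    have h5 : (0 : ℝ) ≤ k := k.cast_nonneg
    rw [abs_le]
    constructor <;> simp only [A] <;> linarith
  have hAi : Integrable (fun ω ↦ A (s ω) ^ 2) P := by
    refine Integrable.of_bound (C := (((k + 1 : ℕ) : ℝ) * u δ + (k + 1)) ^ 2)
      ((hA.comp hm).pow_const 2).aestronglyMeasurable (ae_of_all _ fun ω ↦ ?_)
    rw [Real.norm_eq_abs, abs_pow]
    exact pow_le_pow_left₀ (abs_nonneg _) (hbA ω) 2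
  have hg : Measurable fun p : (ℝ × ℕ) × ℝ ↦ A p.1 * u (p.1.1 - p.2) :=
    (hA.comp measurable_fst).mul (hum.comp (by fun_prop))
  have hmp : Measurable fun ω ↦ (s ω, ξ k ω) := hm.prodMk (hξ k)
  have hgi : Integrable (fun ω ↦ A (s ω) * u ((s ω).1 - ξ k ω)) P := by
    refine Integrable.of_bound (C := (((k + 1 : ℕ) : ℝ) * u δ + (k + 1)) * u δ)
      (hg.comp hmp).aestronglyMeasurable ?_
    filter_upwards [ae_all_iff.2 hpos] with ω hω
    have hx := greedy_room_mem hδ hω k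
    rw [Real.norm_eq_abs, abs_mul, abs_of_nonneg (hunn _)]
    exact mul_le_mul (hbA ω) (humono (by linarith [hω k, hx.2])) (hunn _)
      ((abs_nonneg _).trans (hbA ω))
  have hprod : P.map (fun ω ↦ (s ω, ξ k ω)) = (P.map s).prod μ := by
    rw [← hlaw k]
    exact (indepFun_iff_map_prod_eq_prod_map_map hm.aemeasurable (hξ k).aemeasurable).1
      (indepFun_greedy δ hξ hind k)
  have : IsProbabilityMeasure (P.map s) := Measure.isProbabilityMeasure_map hm.aemeasurable
  have hcross : ∫ ω, A (s ω) * u ((s ω).1 - ξ k ω) ∂P = ∫ ω, A (s ω) * (u (s ω).1 - 1) ∂P := by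
    have h1 : ∫ ω, A (s ω) * u ((s ω).1 - ξ k ω) ∂P
        = ∫ p, A p.1 * u (p.1.1 - p.2) ∂(P.map (fun ω ↦ (s ω, ξ k ω))) :=
      (integral_map hmp.aemeasurable hg.aestronglyMeasurable).symm
    have h2 : Integrable (fun p : (ℝ × ℕ) × ℝ ↦ A p.1 * u (p.1.1 - p.2)) ((P.map s).prod μ) := by
      rw [← hprod, integrable_map_measure hg.aestronglyMeasurable hmp.aemeasurable]
      exact hgi
    rw [h1, hprod, integral_prod _ h2, integral_map hm.aemeasurable
      hg.stronglyMeasurable.integral_prod_right.aestronglyMeasurable]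
    -- The joint law is a product, so the next increment is integrated out first; the room is
    -- nonnegative, so the renewal equation applies to it.
    refine integral_congr_ae ?_
    filter_upwards [ae_all_iff.2 hpos] with ω hω
    have hx := greedy_room_mem hδ hω k
    rw [integral_const_mul, hren _ hx.1]
    ring
  have hci : Integrable (fun ω ↦ A (s ω) * (u (s ω).1 - 1)) P := by
    refine Integrable.of_bound (C := (((k + 1 : ℕ) : ℝ) * u δ + (k + 1)) * (u δ + 1))
      ((hA.comp hm).mul ((hum.comp hm.fst).sub_const 1)).aestronglyMeasurable ?_
    filter_upwards [ae_all_iff.2 hpos] with ω hω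
    have hx := greedy_room_mem hδ hω k
    rw [Real.norm_eq_abs, abs_mul]
    refine mul_le_mul (hbA ω) ?_ (abs_nonneg _) ((abs_nonneg _).trans (hbA ω))
    have h1 := humono hx.2
    have h2 := hunn (s ω).1
    rw [abs_le]
    constructor <;> linarith
  calc ∫ ω, energy u δ (k + 1) (greedy δ (fun i ↦ ξ i ω) (k + 1)) ∂P
      ≤ ∫ ω, (A (s ω) ^ 2 - 2 * (A (s ω) * u ((s ω).1 - ξ k ω))) ∂P := by
        refine integral_mono (integrable_energy_greedy hξ hpos humono hunn hδ (k + 1))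
          (hAi.sub (hgi.const_mul 2)) fun ω ↦ ?_
        refine (energy_greedyStep_le hu0 δ k (s ω) (ξ k ω)).trans_eq ?_
        simp only [A]
        ring
    _ = ∫ ω, (A (s ω) ^ 2 - 2 * (A (s ω) * (u (s ω).1 - 1))) ∂P := by
        rw [integral_sub hAi (hgi.const_mul 2), integral_sub hAi (hci.const_mul 2),
          integral_const_mul, integral_const_mul, hcross]
    _ ≤ ∫ ω, (energy u δ k (s ω) + 2 * u δ) ∂P := by
        refine integral_mono_ae (hAi.sub (hci.const_mul 2))
          ((integrable_energy_greedy hξ hpos humono hunn hδ k).add (integrable_const _)) ?_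
        filter_upwards [ae_all_iff.2 hpos] with ω hω
        have hx := greedy_room_mem hδ hω k
        -- With x the room, A² − 2A(u(x) − 1) equals the energy plus 2u(x) − 1, and u(x) ≤ u(δ).
        have h1 := humono hx.2
        simp only [energy, A]
        nlinarith
    _ = _ := by
        rw [integral_add (integrable_energy_greedy hξ hpos humono hunn hδ k)
          (integrable_const _)]
        simp

/-- The second moment bound for the number of intervals in the greedy covering of a random walk
with nonnegative steps, in terms of a solution `u` of the renewal equation. -/
theorem lintegral_greedy_count_sub_sq_le (hξ : ∀ k, Measurable (ξ k))
    (hpos : ∀ k, ∀ᵐ ω ∂P, 0 ≤ ξ k ω) (hind : iIndepFun ξ P) (hlaw : ∀ k, P.map (ξ k) = μ)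
    (humono : Monotone u) (hunn : ∀ x, 0 ≤ u x) (hu0 : ∀ x < 0, u x = 0)
    (hren : ∀ x, 0 ≤ x → u x = 1 + ∫ y, u (x - y) ∂μ) (hδ : 0 ≤ δ) (m : ℕ) (h : ℝ) :
    ∫⁻ ω, ENNReal.ofReal ((h * u δ * (greedy δ (fun i ↦ ξ i ω) m).2 - h * m) ^ 2) ∂P ≤
      ENNReal.ofReal (4 * (h * m) * (h * u δ) + 2 * (h * u δ) ^ 2) := by
  -- The covering starts with one interval and full room δ, so the initial energy is −u(δ)².
  have hen : ∫ ω, energy u δ m (greedy δ (fun i ↦ ξ i ω) m) ∂P ≤ - u δ ^ 2 + 2 * m * u δ := by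
    induction m with
    | zero => simp [greedy, energy]
    | succ k ih =>
      refine (integral_energy_greedy_succ_le hξ hpos hind hlaw humono hunn hu0 hren hδ k).trans ?_
      push_cast
      linarith
  have hint := integrable_energy_greedy (δ := δ) hξ hpos humono hunn hδ m
  have hint2 : Integrable (fun ω ↦ h ^ 2 * (2 * energy u δ m (greedy δ (fun i ↦ ξ i ω) m)
      + 4 * u δ ^ 2)) P := ((hint.const_mul 2).add (integrable_const _)).const_mul _
  have hle : ∀ᵐ ω ∂P, (h * u δ * (greedy δ (fun i ↦ ξ i ω) m).2 - h * m) ^ 2 ≤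
      h ^ 2 * (2 * energy u δ m (greedy δ (fun i ↦ ξ i ω) m) + 4 * u δ ^ 2) := by
    filter_upwards [ae_all_iff.2 hpos] with ω hω
    have hx := greedy_room_mem hδ hω m
    have h1 := humono hx.2
    have h2 := hunn (greedy δ (fun i ↦ ξ i ω) m).1
    have h3 := pow_le_pow_left₀ h2 h1 2
    rw [energy]
    set n : ℝ := ((greedy δ (fun i ↦ ξ i ω) m).2 : ℝ)
    set v := u (greedy δ (fun i ↦ ξ i ω) m).1
    have : (h * u δ * n - h * m) ^ 2 = h ^ 2 * (n * u δ - m) ^ 2 := by ring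
    rw [this]
    refine mul_le_mul_of_nonneg_left ?_ (sq_nonneg h)
    -- For a = n u(δ) − m, 2((a − v)² − v²) + 4v² − a² = (a − 2v)², and v ≤ u(δ).
    nlinarith [sq_nonneg (n * u δ - m - 2 * v)]
  calc _ ≤ ∫⁻ ω, ENNReal.ofReal (h ^ 2 * (2 * energy u δ m (greedy δ (fun i ↦ ξ i ω) m)
      + 4 * u δ ^ 2)) ∂P :=
        lintegral_mono_ae (hle.mono fun ω hω ↦ ENNReal.ofReal_le_ofReal hω)
    _ = ENNReal.ofReal (∫ ω, h ^ 2 * (2 * energy u δ m (greedy δ (fun i ↦ ξ i ω) m)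
      + 4 * u δ ^ 2) ∂P) :=
        (ofReal_integral_eq_lintegral_ofReal hint2
          (hle.mono fun ω hω ↦ (sq_nonneg _).trans hω)).symm
    _ ≤ _ := by
        refine ENNReal.ofReal_le_ofReal ?_
        rw [integral_const_mul, integral_add (hint.const_mul 2) (integrable_const _),
          integral_const_mul]
        simp only [integral_const, probReal_univ, one_smul]
        nlinarith [mul_le_mul_of_nonneg_left hen (sq_nonneg h)]

end SecondMoment

/-! ### Covering numbers and optimality of the greedy covering -/

lemma CoveredBy.mono {S T : Set ℝ} {δ : ℝ} {n : ℕ} (h : CoveredBy T δ n) (hST : S ⊆ T) :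
    CoveredBy S δ n :=
  let ⟨a, b, hab, hT⟩ := h
  ⟨a, b, hab, hST.trans hT⟩

lemma CoveredBy.mono_length {S : Set ℝ} {δ ε : ℝ} {n : ℕ} (h : CoveredBy S δ n) (hle : δ ≤ ε) :
    CoveredBy S ε n :=
  let ⟨a, b, hab, hT⟩ := h
  ⟨a, b, fun i ↦ ⟨(hab i).1, (hab i).2.trans hle⟩, hT⟩

lemma coveredBy_of_forall_exists {S : Set ℝ} {δ : ℝ} (hδ : 0 ≤ δ) {n : ℕ} (a : Fin n → ℝ)
    (h : ∀ x ∈ S, ∃ i, x ∈ Icc (a i) (a i + δ)) : CoveredBy S δ n :=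
  ⟨a, fun i ↦ a i + δ, fun i ↦ ⟨by linarith, by linarith⟩, fun x hx ↦ mem_iUnion.2 (h x hx)⟩

lemma CoveredBy.exists_left {S : Set ℝ} {δ : ℝ} {n : ℕ} (h : CoveredBy S δ n) :
    ∃ a : Fin n → ℝ, ∀ x ∈ S, ∃ i, x ∈ Icc (a i) (a i + δ) := by
  obtain ⟨a, b, hab, hT⟩ := h
  refine ⟨a, fun x hx ↦ ?_⟩
  obtain ⟨i, hi⟩ := mem_iUnion.1 (hT hx)
  exact ⟨i, hi.1, by linarith [hi.2, (hab i).2]⟩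

lemma coveredBy_of_finset {S : Set ℝ} {δ : ℝ} (hδ : 0 ≤ δ) (F : Finset ℝ)
    (h : ∀ x ∈ S, ∃ a ∈ F, x ∈ Icc a (a + δ)) : CoveredBy S δ F.card := by
  refine coveredBy_of_forall_exists hδ (fun i ↦ (F.equivFin.symm i : ℝ)) fun x hx ↦ ?_
  obtain ⟨a, ha, hxa⟩ := h x hx
  exact ⟨F.equivFin ⟨a, ha⟩, by simpa using hxa⟩

lemma CoveredBy.card_le {S : Set ℝ} {δ : ℝ} {n : ℕ} (h : CoveredBy S δ n) (F : Finset ℝ)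
    (hF : ↑F ⊆ S) (hsep : ∀ a ∈ F, ∀ b ∈ F, a < b → a + δ < b) : F.card ≤ n := by
  obtain ⟨a, ha⟩ := h.exists_left
  choose i hi using ha
  have hinj : Function.Injective fun x : F ↦ i x (hF x.2) := by
    intro x y hxy
    have h1 := hi x (hF x.2)
    have h2 := hi y (hF y.2)
    simp only at hxy
    rw [hxy] at h1
    rcases lt_trichotomy (x : ℝ) y with hlt | heq | hlt
    · linarith [hsep x x.2 y y.2 hlt, h1.1, h2.2]
    · exact Subtype.ext heq
    · linarith [hsep y y.2 x x.2 hlt, h1.2, h2.1]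
  simpa using Fintype.card_le_of_injective _ hinj

lemma coverNumber_le {S : Set ℝ} {δ : ℝ} {n : ℕ} (h : CoveredBy S δ n) : coverNumber S δ ≤ n :=
  iInf₂_le n h

lemma coverNumber_mono {S T : Set ℝ} {δ : ℝ} (hST : S ⊆ T) : coverNumber S δ ≤ coverNumber T δ :=
  le_iInf₂ fun _ hn ↦ coverNumber_le (hn.mono hST)

lemma coverNumber_anti_length {S : Set ℝ} {δ ε : ℝ} (h : δ ≤ ε) :
    coverNumber S ε ≤ coverNumber S δ :=
  le_iInf₂ fun _ hn ↦ coverNumber_le (hn.mono_length h)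

lemma coverNumber_Icc_lt_top {δ : ℝ} (hδ : 0 < δ) (a b : ℝ) : coverNumber (Icc a b) δ < ⊤ := by
  obtain ⟨n, hn⟩ := exists_nat_gt ((b - a) / δ)
  refine (coverNumber_le (n := n) (coveredBy_of_forall_exists hδ.le
    (fun i ↦ a + (i : ℕ) * δ) fun x hx ↦ ?_)).trans_lt (ENat.natCast_lt_top n)
  have h0 : 0 ≤ (x - a) / δ := div_nonneg (sub_nonneg.2 hx.1) hδ.le
  have h1 : (x - a) / δ < n :=
    (div_le_div_of_nonneg_right (by linarith [hx.2]) hδ.le).trans_lt hn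
  have h2 := Nat.floor_le h0
  have h3 := Nat.lt_floor_add_one ((x - a) / δ)
  rw [le_div_iff₀ hδ] at h2
  rw [div_lt_iff₀ hδ] at h3
  exact ⟨⟨⌊(x - a) / δ⌋₊, (Nat.floor_lt h0).2 h1⟩, by simp only; linarith, by simp only; linarith⟩

/-- The left endpoints of the greedy covering of a nondecreasing sequence. -/
lemma exists_finset_greedy {δ : ℝ} (hδ : 0 ≤ δ) {S : ℕ → ℝ} (hS : Monotone S) (m : ℕ) :
    ∃ F : Finset ℝ, ↑F ⊆ S '' Iic m ∧ F.card = (greedy δ (fun k ↦ S (k + 1) - S k) m).2 ∧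
      (∀ k ≤ m, ∃ a ∈ F, S k ∈ Icc a (a + δ)) ∧
      (∀ a ∈ F, ∀ b ∈ F, a < b → a + δ < b) ∧
      S m + (greedy δ (fun k ↦ S (k + 1) - S k) m).1 - δ ∈ F ∧
      ∀ a ∈ F, a ≤ S m + (greedy δ (fun k ↦ S (k + 1) - S k) m).1 - δ := by
  induction m with
  | zero =>
    refine ⟨{S 0}, ?_, ?_, ?_, ?_, ?_, ?_⟩ <;> simp [greedy, hδ]
  | succ m ih =>
    obtain ⟨F, hFS, hcard, hcov, hsep, hlast, hmax⟩ := ih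
    have hroom := greedy_room_mem hδ (ξ := fun k ↦ S (k + 1) - S k)
      (fun k ↦ sub_nonneg.2 (hS k.le_succ)) m
    rw [greedy, greedyStep]
    have hFS' : ↑F ⊆ S '' Iic (m + 1) :=
      hFS.trans (image_mono (Iic_subset_Iic.2 m.le_succ))
    split_ifs with h
    -- The quantity S m + room − δ is the left endpoint of the current interval; it does not move
    -- while values still fit.
    · have he : S (m + 1) + ((greedy δ (fun k ↦ S (k + 1) - S k) m).1 - (S (m + 1) - S m)) - δ
          = S m + (greedy δ (fun k ↦ S (k + 1) - S k) m).1 - δ := by ring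
      refine ⟨F, hFS', hcard, fun k hk ↦ ?_, hsep, ?_, ?_⟩
      · rcases Nat.le_succ_iff.1 hk with hk | rfl
        · exact hcov k hk
        · refine ⟨_, hlast, ?_, by linarith⟩
          linarith [hroom.2, hS m.le_succ]
      · rwa [he]
      · rwa [he]
    · have hnew : ∀ a ∈ F, a + δ < S (m + 1) := fun a ha ↦ by linarith [hmax a ha]
      have hnot : S (m + 1) ∉ F := fun hm ↦ by linarith [hnew _ hm]
      refine ⟨insert (S (m + 1)) F, ?_, ?_, fun k hk ↦ ?_, ?_, ?_, ?_⟩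
      · rw [Finset.coe_insert]
        exact insert_subset ⟨m + 1, self_mem_Iic, rfl⟩ hFS'
      · rw [Finset.card_insert_of_notMem hnot, hcard]
      · rcases Nat.le_succ_iff.1 hk with hk | rfl
        · obtain ⟨a, ha, hka⟩ := hcov k hk
          exact ⟨a, Finset.mem_insert_of_mem ha, hka⟩
        · exact ⟨_, Finset.mem_insert_self _ _, le_rfl, by linarith⟩
      · intro a ha b hb hab
        rcases Finset.mem_insert.1 ha with rfl | ha <;> rcases Finset.mem_insert.1 hb with rfl | hb
        · exact absurd hab (lt_irrefl _)
        · linarith [hnew b hb]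
        · exact hnew a ha
        · exact hsep a ha b hb hab
      · simp
      · intro a ha
        rcases Finset.mem_insert.1 ha with rfl | ha
        · simp
        · linarith [hnew a ha]

lemma coveredBy_greedy {δ : ℝ} (hδ : 0 ≤ δ) {S : ℕ → ℝ} (hS : Monotone S) (m : ℕ) :
    CoveredBy (S '' Iic m) δ (greedy δ (fun k ↦ S (k + 1) - S k) m).2 := by
  obtain ⟨F, -, hcard, hcov, -⟩ := exists_finset_greedy hδ hS m
  rw [← hcard]
  refine coveredBy_of_finset hδ F ?_
  rintro _ ⟨k, hk, rfl⟩
  exact hcov k hk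

/-- The greedy left endpoints belong to the set and are more than δ apart, so no interval of length
δ contains two of them. -/
lemma coverNumber_eq_greedy {δ : ℝ} (hδ : 0 ≤ δ) {S : ℕ → ℝ} (hS : Monotone S) (m : ℕ) :
    coverNumber (S '' Iic m) δ = (greedy δ (fun k ↦ S (k + 1) - S k) m).2 := by
  refine le_antisymm (coverNumber_le (coveredBy_greedy hδ hS m)) (le_iInf₂ fun n hn ↦ ?_)
  obtain ⟨F, hFS, hcard, -, hsep, -⟩ := exists_finset_greedy hδ hS m
  rw [← hcard]
  exact Nat.cast_le.2 (hn.card_le F hFS hsep)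

/-! ### Passage from dyadic grids to the whole range -/

/-- Coverings of an increasing sequence of subsets of a bounded set by the same number of
intervals can be chosen uniformly. -/
lemma CoveredBy.iUnion {S : ℕ → Set ℝ} (hS : Monotone S) {b c δ : ℝ} (hb : ∀ n, S n ⊆ Icc b c)
    (hδ : 0 ≤ δ) {M : ℕ} (h : ∀ n, CoveredBy (S n) δ M) :
    ∃ a : Fin M → ℝ, ⋃ n, S n ⊆ ⋃ i, Icc (a i) (a i + δ) := by
  rcases (⋃ n, S n).eq_empty_or_nonempty with he | ⟨x₀, hx₀⟩
  · exact ⟨fun _ ↦ 0, by simp [he]⟩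
  have hbc : b ≤ c := by
    obtain ⟨n, hn⟩ := mem_iUnion.1 hx₀
    exact (hb n hn).1.trans (hb n hn).2
  -- The tuples of left endpoints that work for `S n`, confined to a box, form a decreasing sequence
  -- of nonempty compact sets; a common point covers every `S n`.
  let K : ℕ → Set (Fin M → ℝ) := fun n ↦
    (Set.pi univ fun _ ↦ Icc (b - δ) c) ∩ ⋂ x ∈ S n, ⋃ i, {a | x ∈ Icc (a i) (a i + δ)}
  have hpi : IsCompact (Set.pi univ fun _ : Fin M ↦ Icc (b - δ) c) :=
    isCompact_univ_pi fun _ ↦ isCompact_Icc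
  have hcl : ∀ n, IsClosed (⋂ x ∈ S n, ⋃ i, {a : Fin M → ℝ | x ∈ Icc (a i) (a i + δ)}) := by
    intro n
    refine isClosed_biInter fun x _ ↦ isClosed_iUnion_of_finite fun i ↦ ?_
    exact (isClosed_le (continuous_apply i) continuous_const).inter
      (isClosed_le continuous_const ((continuous_apply i).add continuous_const))
  have hne : (⋂ n, K n).Nonempty := by
    refine IsCompact.nonempty_iInter_of_sequence_nonempty_isCompact_isClosed K (fun n ↦ ?_)
      (fun n ↦ ?_) (hpi.inter_right (hcl 0)) fun n ↦ hpi.isClosed.inter (hcl n)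
    · exact inter_subset_inter_right _ (biInter_subset_biInter_left (hS n.le_succ))
    · obtain ⟨a, ha⟩ := (h n).exists_left
      -- Clamping the endpoints into the box loses no point of `Icc b c`.
      refine ⟨fun i ↦ max (b - δ) (min (a i) c), ?_, ?_⟩
      · exact fun i _ ↦ ⟨le_max_left _ _, max_le (by linarith) (min_le_right _ _)⟩
      · refine mem_iInter₂.2 fun x hx ↦ mem_iUnion.2 ?_
        obtain ⟨i, hi⟩ := ha x hx
        have hxb := hb n hx
        refine ⟨i, max_le (by linarith [hxb.1]) ((min_le_left _ _).trans hi.1), ?_⟩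
        simp only [min_eq_left (hi.1.trans hxb.2)]
        exact hi.2.trans (add_le_add_left (le_max_right _ _) _)
  obtain ⟨a, ha⟩ := hne
  refine ⟨a, iUnion_subset fun n x hx ↦ ?_⟩
  obtain ⟨i, hi⟩ := mem_iUnion.1 (mem_iInter₂.1 (mem_iInter.1 ha n).2 x hx)
  exact mem_iUnion.2 ⟨i, hi⟩

/-- The times `k h` for `k ≤ 2 ^ n` and `h = t / 2 ^ n`. -/
def dyadicGrid (t : ℝ≥0) (n : ℕ) : Set ℝ≥0 := (fun k : ℕ ↦ k * (t / 2 ^ n)) '' Iic (2 ^ n)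

lemma dyadicGrid_subset_Iic (t : ℝ≥0) (n : ℕ) : dyadicGrid t n ⊆ Iic t := by
  rintro _ ⟨k, hk, rfl⟩
  have hk' : (k : ℝ≥0) ≤ 2 ^ n := by exact_mod_cast hk
  calc (k : ℝ≥0) * (t / 2 ^ n) ≤ 2 ^ n * (t / 2 ^ n) := by gcongr
    _ = t := by field_simp

lemma dyadicGrid_mono (t : ℝ≥0) : Monotone (dyadicGrid t) := by
  refine monotone_nat_of_le_succ fun n ↦ ?_
  rintro _ ⟨k, hk, rfl⟩
  refine ⟨2 * k, ?_, ?_⟩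
  · rw [mem_Iic, pow_succ'] at *
    omega
  · push_cast
    field_simp
    ring

lemma self_mem_dyadicGrid (t : ℝ≥0) (n : ℕ) : t ∈ dyadicGrid t n :=
  ⟨2 ^ n, self_mem_Iic, by push_cast; field_simp⟩

lemma exists_mem_dyadicGrid_between {s r t : ℝ≥0} (hsr : s < r) (hrt : r ≤ t) :
    ∃ n, ∃ q ∈ dyadicGrid t n, s < q ∧ q ≤ r := by
  have ht : 0 < t := (zero_le.trans_lt hsr).trans_le hrt
  obtain ⟨n, hn⟩ := exists_nat_gt (t / (r - s))
  have hrs : 0 < r - s := tsub_pos_of_lt hsr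
  have hh : t / 2 ^ n < r - s := by
    rw [div_lt_iff₀ hrs] at hn
    rw [div_lt_iff₀ (by positivity)]
    refine hn.trans_le ?_
    rw [mul_comm]
    gcongr
    exact_mod_cast n.lt_two_pow_self.le
  have hhpos : 0 < t / 2 ^ n := by positivity
  have h2 := Nat.floor_le (zero_le (a := r / (t / 2 ^ n)))
  have h3 := Nat.lt_floor_add_one (r / (t / 2 ^ n))
  rw [le_div_iff₀ hhpos] at h2
  rw [div_lt_iff₀ hhpos] at h3
  refine ⟨n, _, ⟨⌊r / (t / 2 ^ n)⌋₊, ?_, rfl⟩, ?_, h2⟩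
  · have : (⌊r / (t / 2 ^ n)⌋₊ : ℝ≥0) * (t / 2 ^ n) ≤ 2 ^ n * (t / 2 ^ n) := by
      refine (h2.trans hrt).trans_eq ?_
      field_simp
    have := le_of_mul_le_mul_right this hhpos
    rw [mem_Iic]
    exact_mod_cast this
  · have h4 : s + t / 2 ^ n < r := by
      rw [add_comm]
      exact lt_tsub_iff_right.1 hh
    rw [add_mul, one_mul] at h3
    exact lt_of_add_lt_add_right (h4.trans h3)

/-- Right continuity approximates a value at s < t by grid times just after s. No grid time follows
t, but t lies in every grid. -/
lemma image_Iic_subset_closure {f : ℝ≥0 → ℝ} (hrc : ∀ s, ContinuousWithinAt f (Ici s) s)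
    (t : ℝ≥0) : f '' Iic t ⊆ closure (⋃ n, f '' dyadicGrid t n) := by
  rintro _ ⟨s, hs, rfl⟩
  rcases (mem_Iic.1 hs).eq_or_lt with rfl | hlt
  · exact subset_closure (mem_iUnion.2 ⟨0, s, self_mem_dyadicGrid s 0, rfl⟩)
  refine mem_closure_iff_nhds.2 fun V hV ↦ ?_
  obtain ⟨r, hr, hrV⟩ : ∃ r, s < r ∧ Ico s r ⊆ f ⁻¹' V := by
    have := hrc s hV
    rw [mem_map, mem_nhdsGE_iff_exists_Ico_subset' hlt] at this
    exact this
  obtain ⟨r', h1, h2⟩ := exists_between (lt_min hr hlt)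
  obtain ⟨n, q, hq, hsq, hqr⟩ := exists_mem_dyadicGrid_between h1 (h2.le.trans (min_le_right _ _))
  exact ⟨f q, hrV ⟨hsq.le, hqr.trans_lt (h2.trans_le (min_le_left _ _))⟩,
    mem_iUnion.2 ⟨n, q, hq, rfl⟩⟩

/-- The covering number of the range of a nondecreasing right-continuous function is attained on
all sufficiently fine dyadic grids. -/
lemma eventually_coverNumber_dyadicGrid {f : ℝ≥0 → ℝ} (hf : Monotone f)
    (hrc : ∀ s, ContinuousWithinAt f (Ici s) s) (t : ℝ≥0) {δ : ℝ} (hδ : 0 < δ) {C : ℕ → ℕ}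
    (hC : ∀ n, CoveredBy (f '' dyadicGrid t n) δ (C n))
    (hCe : ∀ n, coverNumber (f '' dyadicGrid t n) δ = C n) :
    ∀ᶠ n in atTop, coverNumber (f '' Iic t) δ = C n := by
  have hsub : ∀ n, f '' dyadicGrid t n ⊆ f '' Iic t :=
    fun n ↦ image_mono (dyadicGrid_subset_Iic t n)
  have hIcc : f '' Iic t ⊆ Icc (f 0) (f t) := by
    rintro _ ⟨s, hs, rfl⟩
    exact ⟨hf zero_le, hf hs⟩
  have hfin : coverNumber (f '' Iic t) δ < ⊤ :=
    (coverNumber_mono hIcc).trans_lt (coverNumber_Icc_lt_top hδ _ _)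
  obtain ⟨N, hN⟩ := ENat.ne_top_iff_exists.1 hfin.ne
  have hCN : ∀ n, C n ≤ N := fun n ↦ by
    have := coverNumber_mono (δ := δ) (hsub n)
    rw [hCe, ← hN] at this
    exact_mod_cast this
  have hCm : Monotone C := fun m n hmn ↦ by
    have := coverNumber_mono (δ := δ) (image_mono (f := f) (dyadicGrid_mono t hmn))
    rw [hCe, hCe] at this
    exact_mod_cast this
  -- The counts are nondecreasing bounded integers, hence attain a maximum and stay there.
  obtain ⟨n₀, hn₀⟩ : ∃ n₀, ∀ n, C n ≤ C n₀ := by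
    have hbdd : (range C).Finite := (finite_Iic N).subset (range_subset_iff.2 hCN)
    obtain ⟨_, ⟨n₀, rfl⟩, hmax⟩ := hbdd.exists_maximal (range_nonempty C)
    exact ⟨n₀, fun n ↦ (le_total (C n) (C n₀)).elim id fun h ↦ hmax ⟨n, rfl⟩ h⟩
  have hall : ∀ n, CoveredBy (f '' dyadicGrid t n) δ (C n₀) := fun n ↦ by
    have hmax : C (max n n₀) = C n₀ := le_antisymm (hn₀ _) (hCm (le_max_right _ _))
    rw [← hmax]
    exact (hC _).mono (image_mono (dyadicGrid_mono t (le_max_left _ _)))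
  obtain ⟨a, ha⟩ := CoveredBy.iUnion
    (fun m n hmn ↦ image_mono (f := f) (dyadicGrid_mono t hmn))
    (fun n ↦ (hsub n).trans hIcc) hδ.le hall
  have hle : coverNumber (f '' Iic t) δ ≤ C n₀ := by
    refine coverNumber_le (coveredBy_of_forall_exists hδ.le a fun x hx ↦ ?_)
    have hcl : IsClosed (⋃ i, Icc (a i) (a i + δ)) :=
      isClosed_iUnion_of_finite fun i ↦ isClosed_Icc
    exact mem_iUnion.1 (closure_minimal ha hcl (image_Iic_subset_closure hrc t hx))
  filter_upwards [eventually_ge_atTop n₀] with n hn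
  refine le_antisymm (hle.trans (Nat.cast_le.2 (hCm hn))) ?_
  rw [← hCe]
  exact coverNumber_mono (hsub n)

/-! ### Unboundedness of the Lévy exponent -/

section LevyExponent

variable {d : ℝ} {Pi : Measure ℝ}

lemma one_sub_exp_neg_mul_nonneg {l y : ℝ} (hl : 0 ≤ l) (hy : 0 < y) :
    0 ≤ 1 - Real.exp (-l * y) := by
  rw [sub_nonneg, Real.exp_le_one_iff]
  nlinarith

/-- Domination by max(1, l) · min(1, y). -/
lemma integrableOn_one_sub_exp (hPi : ∫⁻ y in Ioi (0 : ℝ), ENNReal.ofReal (min 1 y) ∂Pi < ∞)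
    {l : ℝ} (hl : 0 ≤ l) : IntegrableOn (fun y ↦ 1 - Real.exp (-l * y)) (Ioi 0) Pi := by
  have hmin : Integrable (fun y : ℝ ↦ min 1 y) (Pi.restrict (Ioi 0)) := by
    refine ⟨(measurable_const.min measurable_id).aestronglyMeasurable, ?_⟩
    rw [hasFiniteIntegral_iff_ofReal]
    · exact hPi
    · filter_upwards [ae_restrict_mem measurableSet_Ioi] with y hy
      exact le_min zero_le_one (le_of_lt hy)
  refine (hmin.const_mul (max 1 l)).mono' (by fun_prop) ?_
  filter_upwards [ae_restrict_mem measurableSet_Ioi] with y hy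
  have hy0 : (0 : ℝ) < y := hy
  rw [Real.norm_eq_abs, abs_of_nonneg (one_sub_exp_neg_mul_nonneg hl hy0)]
  have h1 := Real.add_one_le_exp (-l * y)
  have h2 := Real.exp_pos (-l * y)
  have h3 := le_max_left 1 l
  have h4 := le_max_right 1 l
  rcases le_total 1 y with h | h
  · rw [min_eq_left h]
    linarith
  · rw [min_eq_right h]
    nlinarith

/-- This is where compound Poisson processes are excluded. If Π is infinite, some (1/(n+1), ∞) has
mass above 2M, and for l = n + 1 the integrand there is at least 1 − 1/e ≥ 1/2. Otherwise the drift
term d l suffices. -/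
lemma exists_le_levyExponent (hd : 0 ≤ d)
    (hPi : ∫⁻ y in Ioi (0 : ℝ), ENNReal.ofReal (min 1 y) ∂Pi < ∞)
    (hne : Pi (Ioi 0) = ∞ ∨ (Pi (Ioi 0) < ∞ ∧ 0 < d)) (M : ℝ) :
    ∃ l, 0 < l ∧ M ≤ levyExponent d Pi l := by
  have hnn : ∀ l : ℝ, 0 ≤ l → 0 ≤ ∫ y in Ioi (0 : ℝ), (1 - Real.exp (-l * y)) ∂Pi :=
    fun l hl ↦ setIntegral_nonneg measurableSet_Ioi
      fun y hy ↦ one_sub_exp_neg_mul_nonneg hl hy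
  rcases hne with hinf | ⟨-, hd0⟩
  · have hU : ⋃ n : ℕ, Ioi (1 / ((n : ℝ) + 1)) = Ioi 0 := by
      ext y
      simp only [mem_iUnion, mem_Ioi]
      exact ⟨fun ⟨n, hn⟩ ↦ lt_trans (by positivity) hn, fun hy ↦ exists_nat_one_div_lt hy⟩
    have hmono : Monotone fun n : ℕ ↦ Ioi (1 / ((n : ℝ) + 1)) := fun m n hmn ↦
      Ioi_subset_Ioi (one_div_le_one_div_of_le (by positivity) (by gcongr))
    have ht := tendsto_measure_iUnion_atTop (μ := Pi) hmono
    rw [hU, hinf] at ht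
    obtain ⟨n, hn⟩ := (ht.eventually (lt_mem_nhds (a := ENNReal.ofReal (2 * M))
      ENNReal.ofReal_lt_top)).exists
    have hl : (0 : ℝ) < n + 1 := by positivity
    refine ⟨n + 1, hl, ?_⟩
    have hint := integrableOn_one_sub_exp hPi hl.le
    suffices h : ENNReal.ofReal M ≤
        ENNReal.ofReal (∫ y in Ioi (0 : ℝ), (1 - Real.exp (-(n + 1 : ℝ) * y)) ∂Pi) by
      have := (ENNReal.ofReal_le_ofReal_iff (hnn _ hl.le)).1 h
      rw [levyExponent]
      nlinarith
    rw [ofReal_integral_eq_lintegral_ofReal hint]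
    · calc ENNReal.ofReal M = ENNReal.ofReal (1 / 2) * ENNReal.ofReal (2 * M) := by
            rw [← ENNReal.ofReal_mul (by norm_num)]
            ring_nf
        _ ≤ ENNReal.ofReal (1 / 2) * Pi (Ioi (1 / ((n : ℝ) + 1))) :=
            mul_le_mul_right hn.le _
        _ = ∫⁻ _ in Ioi (1 / ((n : ℝ) + 1)), ENNReal.ofReal (1 / 2) ∂Pi := by simp
        _ ≤ ∫⁻ y in Ioi (1 / ((n : ℝ) + 1)),
            ENNReal.ofReal (1 - Real.exp (-(n + 1 : ℝ) * y)) ∂Pi := by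
            refine setLIntegral_mono (by fun_prop) fun y hy ↦ ENNReal.ofReal_le_ofReal ?_
            have h1 : 1 ≤ (n + 1 : ℝ) * y := by
              have := mem_Ioi.1 hy
              rw [div_lt_iff₀ hl] at this
              linarith
            have h2 : Real.exp (-(n + 1 : ℝ) * y) ≤ Real.exp (-1) :=
              Real.exp_le_exp.2 (by linarith)
            have h3 : Real.exp (-1) ≤ 1 / 2 := by
              rw [Real.exp_neg, inv_eq_one_div]
              exact one_div_le_one_div_of_le two_pos (by linarith [Real.add_one_le_exp (1 : ℝ)])
            linarith
        _ ≤ _ := lintegral_mono_set (Ioi_subset_Ioi (by positivity))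
    · filter_upwards [ae_restrict_mem measurableSet_Ioi] with y hy
      exact one_sub_exp_neg_mul_nonneg hl.le hy
  · refine ⟨max 1 (M / d), by positivity, ?_⟩
    have h1 := hnn (max 1 (M / d)) (by positivity)
    have h2 : M / d ≤ max 1 (M / d) := le_max_right _ _
    rw [div_le_iff₀ hd0] at h2
    rw [levyExponent]
    linarith

end LevyExponent

/-! ### First passage times -/

section FirstPassage

variable {Ω : Type*} {X : ℝ≥0 → Ω → ℝ} {ω : Ω}

lemma le_firstPassage (hmono : Monotone fun t ↦ X t ω) {s : ℝ≥0} {δ : ℝ} (h : X s ω ≤ δ) :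
    (s : ℝ≥0∞) ≤ firstPassage X δ ω :=
  le_iInf₂ fun _ ht ↦ ENNReal.coe_le_coe.2 (hmono.reflect_lt (h.trans_lt ht)).le

lemma firstPassage_le {s : ℝ≥0} {δ : ℝ} (h : δ < X s ω) : firstPassage X δ ω ≤ s :=
  iInf₂_le s h

lemma firstPassage_mono : Monotone fun δ ↦ firstPassage X δ ω :=
  fun _ _ hab ↦ le_iInf₂ fun _ ht ↦ firstPassage_le (hab.trans_lt ht)

lemma firstPassage_zero (hmono : StrictMono fun t ↦ X t ω) (h0 : X 0 ω = 0) :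
    firstPassage X 0 ω = 0 := by
  refine le_antisymm (ENNReal.le_of_forall_pos_le_add fun ε hε _ ↦ ?_) zero_le
  rw [zero_add]
  refine firstPassage_le ?_
  rw [← h0]
  exact hmono hε

/-- First passage inverts the path, and a jump of the inverse would be a flat stretch of the path.
-/
lemma continuous_firstPassage (hmono : StrictMono fun t ↦ X t ω) :
    Continuous fun δ ↦ firstPassage X δ ω := by
  refine continuous_iff_continuousAt.2 fun δ ↦ tendsto_order.2 ⟨fun a ha ↦ ?_, fun b hb ↦ ?_⟩
  · obtain ⟨c, hac, hc⟩ := ENNReal.lt_iff_exists_nnreal_btwn.1 ha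
    obtain ⟨b, hab, hbc⟩ := ENNReal.lt_iff_exists_nnreal_btwn.1 hac
    have h1 : X c ω ≤ δ := not_lt.1 fun h ↦ (firstPassage_le h).not_gt hc
    have h2 : X b ω < δ := (hmono (ENNReal.coe_lt_coe.1 hbc)).trans_le h1
    filter_upwards [lt_mem_nhds h2] with δ' hδ'
    exact hab.trans_le (le_firstPassage hmono.monotone hδ'.le)
  · simp only [firstPassage, iInf_lt_iff] at hb
    obtain ⟨t, ht, htb⟩ := hb
    filter_upwards [gt_mem_nhds ht] with δ' hδ'
    exact (firstPassage_le hδ').trans_lt htb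

lemma firstPassage_eq_iInf_dense {D : Set ℝ≥0} (hD : Dense D) (hmono : Monotone fun t ↦ X t ω)
    (δ : ℝ) : firstPassage X δ ω = ⨅ q : D, if δ < X q ω then ((q : ℝ≥0) : ℝ≥0∞) else ∞ := by
  refine le_antisymm (le_iInf fun q ↦ ?_) (le_iInf₂ fun t ht ↦ le_of_forall_gt fun c hc ↦ ?_)
  · split_ifs with h
    · exact firstPassage_le h
    · exact le_top
  · obtain ⟨r, htr, hrc⟩ := ENNReal.lt_iff_exists_nnreal_btwn.1 hc
    obtain ⟨q, hq, hq1, hq2⟩ := hD.exists_between (ENNReal.coe_lt_coe.1 htr)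
    refine (iInf_le _ ⟨q, hq⟩).trans_lt ?_
    rw [if_pos (ht.trans_le (hmono hq1.le))]
    exact (ENNReal.coe_lt_coe.2 hq2).trans hrc

/-- The first passage time compared with the number of grid points at which the path has not yet
passed. -/
lemma firstPassage_le_mul_tsum {h : ℝ≥0} (hh : 0 < h) (δ : ℝ) :
    firstPassage X δ ω ≤
      h * ∑' k : ℕ, {ω | X (k * h) ω ≤ δ}.indicator (1 : Ω → ℝ≥0∞) ω := by
  classical
  by_cases hex : ∃ k : ℕ, δ < X (k * h) ω
  · refine (firstPassage_le (Nat.find_spec hex)).trans ?_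
    push_cast
    rw [mul_comm]
    gcongr
    refine le_trans ?_ (ENNReal.sum_le_tsum (Finset.range (Nat.find hex)))
    rw [Finset.sum_congr rfl (g := fun _ ↦ 1)]
    · simp
    · intro k hk
      have hk' : ω ∈ {ω | X (k * h) ω ≤ δ} := not_lt.1 (Nat.find_min hex (Finset.mem_range.1 hk))
      rw [indicator_of_mem hk', Pi.one_apply]
  · push Not at hex
    have : ∑' k : ℕ, {ω | X (k * h) ω ≤ δ}.indicator (1 : Ω → ℝ≥0∞) ω = ∞ := by
      rw [tsum_congr (g := fun _ ↦ (1 : ℝ≥0∞))]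
      · exact ENNReal.tsum_const_eq_top_of_ne_zero one_ne_zero
      · intro k
        have hk : ω ∈ {ω | X (k * h) ω ≤ δ} := hex k
        rw [indicator_of_mem hk, Pi.one_apply]
    rw [this, ENNReal.mul_top (by simpa using hh.ne')]
    exact le_top

/-- If the path is at most δ at time nh, then T₁ ≥ nh, while the n + 1 indicators up to then add at
most (n + 1)h; the surplus h comes from counting time 0. -/
lemma mul_tsum_le_firstPassage_add (hmono : Monotone fun t ↦ X t ω) (h : ℝ≥0) (δ : ℝ) :
    h * ∑' k : ℕ, {ω | X (k * h) ω ≤ δ}.indicator (1 : Ω → ℝ≥0∞) ω ≤ firstPassage X δ ω + h := by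
  have hk : ∀ n : ℕ, (h : ℝ≥0∞) * ∑ k ∈ Finset.range n,
      {ω | X (k * h) ω ≤ δ}.indicator (1 : Ω → ℝ≥0∞) ω ≤ firstPassage X δ ω + h := by
    intro n
    induction n with
    | zero => simp
    | succ n ih =>
      by_cases hn : X (n * h) ω ≤ δ
      · calc (h : ℝ≥0∞) * ∑ k ∈ Finset.range (n + 1),
            {ω | X (k * h) ω ≤ δ}.indicator (1 : Ω → ℝ≥0∞) ω
            ≤ h * ∑ k ∈ Finset.range (n + 1), 1 := by
              gcongr
              exact indicator_le_self' (fun _ _ ↦ zero_le) _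
          _ = ((n * h : ℝ≥0) : ℝ≥0∞) + h := by
              push_cast
              simp
              ring
          _ ≤ _ := by
              gcongr
              exact le_firstPassage hmono hn
      · rw [Finset.sum_range_succ, indicator_of_notMem (by exact hn), add_zero]
        exact ih
  rw [ENNReal.tsum_eq_iSup_nat, ENNReal.mul_iSup]
  exact iSup_le hk

end FirstPassage

/-! ### Strict monotonicity of the paths -/

variable {Ω : Type*} [MeasurableSpace Ω] {P : Measure Ω}
  {X : ℝ≥0 → Ω → ℝ} {d : ℝ} {Pi : Measure ℝ}

namespace IsSubordinator

lemma ae_nonneg (hX : IsSubordinator X P) : ∀ᵐ ω ∂P, ∀ t, 0 ≤ X t ω := by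
  filter_upwards [hX.start, hX.mono] with ω h0 hm t
  exact h0.symm.le.trans (hm zero_le)

/-- Chernoff bound. Large l at a = 0 gives strict positivity of X; a fixed l makes the renewal
series geometric. -/
lemma measure_le_le_exp [IsProbabilityMeasure P] (hX : IsSubordinator X P)
    (hchar : HasDriftAndLevyMeasure X P d Pi) (s : ℝ≥0) {l : ℝ} (hl : 0 < l) (a : ℝ) :
    P {ω | X s ω ≤ a} ≤
      ENNReal.ofReal (Real.exp (l * a) * Real.exp (-s * levyExponent d Pi l)) := by
  have hm := hX.measurable s
  have hint : Integrable (fun ω ↦ Real.exp (l * a) * Real.exp (-l * X s ω)) P := by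
    refine Integrable.const_mul ?_ _
    refine Integrable.of_bound (C := 1) (by fun_prop) ?_
    filter_upwards [hX.ae_nonneg] with ω hω
    rw [Real.norm_eq_abs, Real.abs_exp, Real.exp_le_one_iff]
    nlinarith [hω s]
  rw [← hchar.laplace s l hl, ← integral_const_mul,
    ofReal_integral_eq_lintegral_ofReal hint (ae_of_all _ fun ω ↦ by positivity)]
  calc P {ω | X s ω ≤ a} = ∫⁻ _ in {ω | X s ω ≤ a}, 1 ∂P := by simp
    _ ≤ ∫⁻ ω in {ω | X s ω ≤ a}, ENNReal.ofReal (Real.exp (l * a) * Real.exp (-l * X s ω)) ∂P := by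
        refine setLIntegral_mono (by fun_prop) fun ω hω ↦ ?_
        rw [ENNReal.one_le_ofReal, ← Real.exp_add, Real.one_le_exp_iff]
        have : X s ω ≤ a := hω
        nlinarith
    _ ≤ _ := setLIntegral_le_lintegral _ _

lemma measure_le_zero_eq_zero [IsProbabilityMeasure P] (hX : IsSubordinator X P)
    (hchar : HasDriftAndLevyMeasure X P d Pi)
    (hne : Pi (Ioi 0) = ∞ ∨ (Pi (Ioi 0) < ∞ ∧ 0 < d)) {s : ℝ≥0} (hs : 0 < s) :
    P {ω | X s ω ≤ 0} = 0 := by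
  have hb : ∀ M : ℝ, P {ω | X s ω ≤ 0} ≤ ENNReal.ofReal (Real.exp (-(s * M))) := fun M ↦ by
    obtain ⟨l, hl, hM⟩ := exists_le_levyExponent hchar.drift_nonneg
      hchar.lintegral_min_lt_top hne M
    refine (hX.measure_le_le_exp hchar s hl 0).trans (ENNReal.ofReal_le_ofReal ?_)
    rw [mul_zero, Real.exp_zero, one_mul]
    exact Real.exp_le_exp.2 (by nlinarith [s.coe_nonneg])
  have hs' : (0 : ℝ) < s := hs
  have ht : Tendsto (fun M : ℝ ↦ ENNReal.ofReal (Real.exp (-(s * M)))) atTop (𝓝 0) := by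
    rw [← ENNReal.ofReal_zero]
    exact ENNReal.tendsto_ofReal
      (Real.tendsto_exp_neg_atTop_nhds_zero.comp (tendsto_id.const_mul_atTop hs'))
  exact le_antisymm (ge_of_tendsto' ht hb) zero_le

lemma ae_strictMono [IsProbabilityMeasure P] (hX : IsSubordinator X P)
    (hchar : HasDriftAndLevyMeasure X P d Pi)
    (hne : Pi (Ioi 0) = ∞ ∨ (Pi (Ioi 0) < ∞ ∧ 0 < d)) :
    ∀ᵐ ω ∂P, StrictMono fun t ↦ X t ω := by
  obtain ⟨D, hDc, hD⟩ := TopologicalSpace.exists_countable_dense ℝ≥0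
  have : Countable D := hDc
  have hq : ∀ q r : D, (q : ℝ≥0) < r → ∀ᵐ ω ∂P, X q ω < X r ω := by
    intro q r hqr
    have h1 := (hX.stationary_increments q (r - q)).measure_mem_eq (s := Iic 0) measurableSet_Iic
    rw [add_tsub_cancel_of_le hqr.le] at h1
    have h2 := hX.measure_le_zero_eq_zero hchar hne (tsub_pos_of_lt hqr)
    have h3 : P {ω | X r ω - X q ω ≤ 0} = 0 := h1.trans h2
    rw [ae_iff]
    simpa [not_lt] using h3
  have hall : ∀ᵐ ω ∂P, ∀ q r : D, (q : ℝ≥0) < r → X q ω < X r ω :=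
    ae_all_iff.2 fun q ↦ ae_all_iff.2 fun r ↦ by
      by_cases hqr : (q : ℝ≥0) < r
      · exact (hq q r hqr).mono fun _ h _ ↦ h
      · exact ae_of_all _ fun _ h ↦ absurd h hqr
  filter_upwards [hall, hX.mono] with ω hω hm s t hst
  obtain ⟨q, hqD, hsq, hqt⟩ := hD.exists_between hst
  obtain ⟨r, hrD, hqr, hrt⟩ := hD.exists_between hqt
  exact (hm hsq.le).trans_lt ((hω ⟨q, hqD⟩ ⟨r, hrD⟩ hqr).trans_le (hm hrt.le))

lemma aemeasurable_firstPassage (hX : IsSubordinator X P) (δ : ℝ) :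
    AEMeasurable (firstPassage X δ) P := by
  obtain ⟨D, hDc, hD⟩ := TopologicalSpace.exists_countable_dense ℝ≥0
  have : Countable D := hDc
  refine ⟨fun ω ↦ ⨅ q : D, if δ < X q ω then ((q : ℝ≥0) : ℝ≥0∞) else ∞,
    Measurable.iInf fun q ↦ Measurable.ite
      (measurableSet_lt measurable_const (hX.measurable q)) measurable_const measurable_const, ?_⟩
  filter_upwards [hX.mono] with ω hω
  exact firstPassage_eq_iInf_dense hD hω δ

end IsSubordinator

/-! ### Renewal function and potential -/

/-- The renewal function `x ↦ ∑ₖ P (X_{k h} ≤ x)` of the random walk `(X_{k h})ₖ`. -/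
noncomputable def renewal (X : ℝ≥0 → Ω → ℝ) (P : Measure Ω) (h : ℝ≥0) (x : ℝ) : ℝ≥0∞ :=
  ∑' k : ℕ, P {ω | X (k * h) ω ≤ x}

lemma renewal_mono (h : ℝ≥0) : Monotone (renewal X P h) :=
  fun _ _ hxy ↦ ENNReal.tsum_le_tsum fun _ ↦ measure_mono fun _ hω ↦ le_trans hω hxy

namespace IsSubordinator

lemma renewal_lt_top [IsProbabilityMeasure P] (hX : IsSubordinator X P)
    (hchar : HasDriftAndLevyMeasure X P d Pi)
    (hne : Pi (Ioi 0) = ∞ ∨ (Pi (Ioi 0) < ∞ ∧ 0 < d)) {h : ℝ≥0} (hh : 0 < h) (x : ℝ) :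
    renewal X P h x < ∞ := by
  obtain ⟨l, hl, hM⟩ := exists_le_levyExponent hchar.drift_nonneg
    hchar.lintegral_min_lt_top hne 1
  have hh' : (0 : ℝ) < h := hh
  have hr : Real.exp (-h * levyExponent d Pi l) < 1 := by
    rw [Real.exp_lt_one_iff]
    nlinarith
  have hs : Summable fun k : ℕ ↦
      Real.exp (l * x) * Real.exp (-(k * h : ℝ≥0) * levyExponent d Pi l) := by
    refine ((summable_geometric_of_lt_one (Real.exp_pos _).le hr).mul_left
      (Real.exp (l * x))).congr fun k ↦ ?_
    rw [← Real.exp_nat_mul]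
    push_cast
    ring_nf
  refine (ENNReal.tsum_le_tsum fun k : ℕ ↦ hX.measure_le_le_exp hchar (k * h) hl x).trans_lt ?_
  rw [← ENNReal.ofReal_tsum_of_nonneg (fun k ↦ by positivity) hs]
  exact ENNReal.ofReal_lt_top

lemma renewal_of_neg (hX : IsSubordinator X P) (h : ℝ≥0) {x : ℝ} (hx : x < 0) :
    renewal X P h x = 0 := by
  refine ENNReal.tsum_eq_zero.2 fun k ↦ ?_
  have h1 : ∀ᵐ ω ∂P, ¬ X (k * h) ω ≤ x := by
    filter_upwards [hX.ae_nonneg] with ω hω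
    exact not_le.2 (hx.trans_le (hω _))
  simpa [ae_iff] using h1

/-- First-step decomposition: after time h the increment over a time kh is independent of X_h and
distributed as X_{kh}. -/
lemma measure_succ_le_eq [IsProbabilityMeasure P] (hX : IsSubordinator X P) (h : ℝ≥0) (k : ℕ)
    (x : ℝ) : P {ω | X ((k + 1 : ℕ) * h) ω ≤ x} =
      ∫⁻ y, P {ω | X (k * h) ω ≤ x - y} ∂(P.map (X h)) := by
  have he : ((k + 1 : ℕ) : ℝ≥0) * h = h + k * h := by push_cast; ring
  have hind := hX.indep_increments.indepFun_eval_sub (zero_le (a := h))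
    (le_self_add (a := h) (b := k * h)) hX.start
  have hm1 := hX.measurable h
  have hm2 : Measurable (X (h + k * h) - X h) := (hX.measurable _).sub hm1
  have hprod := (indepFun_iff_map_prod_eq_prod_map_map hm1.aemeasurable hm2.aemeasurable).1 hind
  have hlaw : P.map (X (h + k * h) - X h) = P.map (X (k * h)) :=
    (hX.stationary_increments h (k * h)).map_eq
  have hs : MeasurableSet {p : ℝ × ℝ | p.1 + p.2 ≤ x} :=
    measurableSet_le (by fun_prop) measurable_const
  have h1 : P {ω | X ((k + 1 : ℕ) * h) ω ≤ x} =
      P.map (fun ω ↦ (X h ω, (X (h + k * h) - X h) ω)) {p : ℝ × ℝ | p.1 + p.2 ≤ x} := by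
    rw [Measure.map_apply (hm1.prodMk hm2) hs, he]
    congr 1
    ext ω
    simp
  have := Measure.isProbabilityMeasure_map (μ := P) (hX.measurable (k * h)).aemeasurable
  rw [h1, hprod, hlaw, Measure.prod_apply hs]
  refine lintegral_congr fun y ↦ ?_
  rw [Measure.map_apply (hX.measurable _) (measurable_prodMk_left hs)]
  congr 1
  ext ω
  simp [le_sub_iff_add_le']

lemma renewal_eq [IsProbabilityMeasure P] (hX : IsSubordinator X P) (h : ℝ≥0) {x : ℝ}
    (hx : 0 ≤ x) : renewal X P h x = 1 + ∫⁻ y, renewal X P h (x - y) ∂(P.map (X h)) := by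
  have h0 : P {ω | X ((0 : ℕ) * h) ω ≤ x} = 1 := by
    have h1 : ∀ᵐ ω ∂P, ω ∈ {ω | X ((0 : ℕ) * h) ω ≤ x} := by
      filter_upwards [hX.start] with ω hω
      simpa [hω] using hx
    exact (measure_congr (eventuallyEq_univ.2 h1)).trans measure_univ
  have hmeas : ∀ k : ℕ, Measurable fun y ↦ P {ω | X (k * h) ω ≤ x - y} := fun k ↦ by
    have : Antitone fun y ↦ P {ω | X (k * h) ω ≤ x - y} := fun a b hab ↦
      measure_mono fun ω hω ↦ le_trans (b := x - b) hω (by linarith)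
    exact this.measurable
  simp only [renewal]
  rw [lintegral_tsum fun k ↦ (hmeas k).aemeasurable, tsum_eq_zero_add' ENNReal.summable, h0]
  simp_rw [hX.measure_succ_le_eq]

lemma toReal_renewal_eq [IsProbabilityMeasure P] (hX : IsSubordinator X P) {h : ℝ≥0}
    (hfin : ∀ x, renewal X P h x < ∞) {x : ℝ} (hx : 0 ≤ x) :
    (renewal X P h x).toReal = 1 + ∫ y, (renewal X P h (x - y)).toReal ∂(P.map (X h)) := by
  have heq := hX.renewal_eq h hx
  have hne : ∫⁻ y, renewal X P h (x - y) ∂(P.map (X h)) ≠ ∞ := fun htop ↦ by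
    rw [htop, add_top] at heq
    exact (hfin x).ne heq
  rw [integral_toReal, heq, ENNReal.toReal_add ENNReal.one_ne_top hne, ENNReal.toReal_one]
  · exact ((renewal_mono h).measurable.comp (measurable_const.sub measurable_id)).aemeasurable
  · exact ae_of_all _ fun y ↦ hfin _

lemma lintegral_tsum_indicator (hX : IsSubordinator X P) (h : ℝ≥0) (δ : ℝ) :
    ∫⁻ ω, h * ∑' k : ℕ, {ω | X (k * h) ω ≤ δ}.indicator (1 : Ω → ℝ≥0∞) ω ∂P =
      h * renewal X P h δ := by
  have hs : ∀ k : ℕ, MeasurableSet {ω | X (k * h) ω ≤ δ} :=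
    fun k ↦ measurableSet_le (hX.measurable _) measurable_const
  rw [lintegral_const_mul' _ _ ENNReal.coe_ne_top, lintegral_tsum
    fun k ↦ (measurable_one.indicator (hs k)).aemeasurable]
  simp_rw [lintegral_indicator_one (hs _), renewal]

lemma potential_le_mul_renewal (hX : IsSubordinator X P) {h : ℝ≥0} (hh : 0 < h) (δ : ℝ) :
    potential X P δ ≤ h * renewal X P h δ := by
  rw [← hX.lintegral_tsum_indicator]
  exact lintegral_mono fun ω ↦ firstPassage_le_mul_tsum hh δ

lemma mul_renewal_le_potential_add [IsProbabilityMeasure P] (hX : IsSubordinator X P) (h : ℝ≥0)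
    (δ : ℝ) : h * renewal X P h δ ≤ potential X P δ + h := by
  rw [← hX.lintegral_tsum_indicator]
  calc _ ≤ ∫⁻ ω, (firstPassage X δ ω + h) ∂P :=
        lintegral_mono_ae (hX.mono.mono fun ω hω ↦ mul_tsum_le_firstPassage_add hω h δ)
    _ = _ := by
        rw [lintegral_add_right _ measurable_const]
        simp [potential]

end IsSubordinator

lemma potential_mono : Monotone (potential X P) :=
  fun _ _ hab ↦ lintegral_mono fun _ ↦ firstPassage_mono hab

namespace IsSubordinator

lemma potential_lt_top [IsProbabilityMeasure P] (hX : IsSubordinator X P)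
    (hchar : HasDriftAndLevyMeasure X P d Pi)
    (hne : Pi (Ioi 0) = ∞ ∨ (Pi (Ioi 0) < ∞ ∧ 0 < d)) (δ : ℝ) : potential X P δ < ∞ :=
  (hX.potential_le_mul_renewal one_pos δ).trans_lt
    (ENNReal.mul_lt_top ENNReal.coe_lt_top (hX.renewal_lt_top hchar hne one_pos δ))

lemma continuous_potential [IsProbabilityMeasure P] (hX : IsSubordinator X P)
    (hchar : HasDriftAndLevyMeasure X P d Pi)
    (hne : Pi (Ioi 0) = ∞ ∨ (Pi (Ioi 0) < ∞ ∧ 0 < d)) : Continuous (potential X P) := by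
  refine continuous_iff_continuousAt.2 fun δ ↦ ?_
  refine tendsto_lintegral_filter_of_dominated_convergence' (firstPassage X (δ + 1))
    (Eventually.of_forall fun a ↦ hX.aemeasurable_firstPassage a) ?_
    (hX.potential_lt_top hchar hne _).ne ?_
  · filter_upwards [gt_mem_nhds (lt_add_one δ)] with a ha
    exact ae_of_all _ fun ω ↦ firstPassage_mono ha.le
  · filter_upwards [hX.ae_strictMono hchar hne] with ω hω
    exact (continuous_firstPassage hω).tendsto δ

lemma potential_zero [IsProbabilityMeasure P] (hX : IsSubordinator X P)
    (hchar : HasDriftAndLevyMeasure X P d Pi)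
    (hne : Pi (Ioi 0) = ∞ ∨ (Pi (Ioi 0) < ∞ ∧ 0 < d)) : potential X P 0 = 0 := by
  rw [potential, lintegral_eq_zero_iff' (hX.aemeasurable_firstPassage 0)]
  filter_upwards [hX.ae_strictMono hchar hne, hX.start] with ω hω h0
  exact firstPassage_zero hω h0

lemma tendsto_mul_renewal [IsProbabilityMeasure P] (hX : IsSubordinator X P)
    (hchar : HasDriftAndLevyMeasure X P d Pi)
    (hne : Pi (Ioi 0) = ∞ ∨ (Pi (Ioi 0) < ∞ ∧ 0 < d)) {t : ℝ≥0} (ht : 0 < t) (δ : ℝ) :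
    Tendsto (fun n : ℕ ↦ ((t / 2 ^ n : ℝ≥0) : ℝ) * (renewal X P (t / 2 ^ n) δ).toReal) atTop
      (𝓝 (potential X P δ).toReal) := by
  have hpos : ∀ n : ℕ, 0 < t / 2 ^ n := fun n ↦ by positivity
  have hh : Tendsto (fun n : ℕ ↦ t / 2 ^ n) atTop (𝓝 0) := by
    have := (NNReal.tendsto_pow_atTop_nhds_zero_of_lt_one (r := (1 / 2 : ℝ≥0))
      (by rw [← NNReal.coe_lt_coe]; norm_num)).const_mul t
    rw [mul_zero] at this
    refine this.congr fun n ↦ ?_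
    rw [one_div, inv_pow, div_eq_mul_inv]
  have hh' : Tendsto (fun n : ℕ ↦ ((t / 2 ^ n : ℝ≥0) : ℝ≥0∞)) atTop (𝓝 0) :=
    ENNReal.tendsto_coe.2 hh
  have hlim : Tendsto (fun n : ℕ ↦ ((t / 2 ^ n : ℝ≥0) : ℝ≥0∞) * renewal X P (t / 2 ^ n) δ) atTop
      (𝓝 (potential X P δ)) := by
    refine tendsto_of_tendsto_of_tendsto_of_le_of_le tendsto_const_nhds
      (h := fun n : ℕ ↦ potential X P δ + ((t / 2 ^ n : ℝ≥0) : ℝ≥0∞)) ?_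
      (fun n ↦ hX.potential_le_mul_renewal (hpos n) δ)
      fun n ↦ hX.mul_renewal_le_potential_add _ δ
    simpa using hh'.const_add (potential X P δ)
  refine ((ENNReal.tendsto_toReal (hX.potential_lt_top hchar hne δ).ne).comp hlim).congr fun n ↦ ?_
  simp

end IsSubordinator

/-! ### From a sequence of scales to all scales -/

/-- A product of a nondecreasing factor `U` tending to `0` at `0` and a nonincreasing
factor `N` converges at `0` as soon as it does along points where `U` equals `c / (n + 1) ^ 2`. -/
lemma tendsto_mul_of_tendsto_subseq {U N : ℝ → ℝ} {c t : ℝ} (hc : 0 < c) (hU : Monotone U)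
    (hUpos : ∀ x, 0 < x → 0 < U x) (hU0 : Tendsto U (𝓝[>] 0) (𝓝 0))
    (hN : ∀ x y, 0 < x → x ≤ y → N y ≤ N x) (hNnn : ∀ x, 0 ≤ N x) {δ : ℕ → ℝ}
    (hδ : ∀ n, 0 < δ n) (hUδ : ∀ n, U (δ n) = c / ((n : ℝ) + 1) ^ 2)
    (hlim : Tendsto (fun n ↦ U (δ n) * N (δ n)) atTop (𝓝 t)) :
    Tendsto (fun x ↦ U x * N x) (𝓝[>] 0) (𝓝 t) := by
  have hU0' : Tendsto U (𝓝[>] 0) (𝓝[>] 0) :=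
    tendsto_nhdsWithin_iff.2 ⟨hU0, by
      filter_upwards [self_mem_nhdsWithin] with x hx using hUpos x hx⟩
  have hs : Tendsto (fun x ↦ √(c / U x)) (𝓝[>] 0) atTop :=
    Real.tendsto_sqrt_atTop.comp (by
      simp_rw [div_eq_mul_inv]
      exact (tendsto_inv_nhdsGT_zero.comp hU0').const_mul_atTop hc)
  -- With m + 2 = ⌊√(c / U x)⌋, U(δ (m+2)) < U x < U(δ m). Subtracting 2 rather than 1 makes the
  -- upper inequality strict, so monotonicity of U can be reversed to order x against δ m.
  have hm : Tendsto (fun x ↦ ⌊√(c / U x)⌋₊ - 2) (𝓝[>] 0) atTop :=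
    (tendsto_sub_atTop_nat 2).comp (tendsto_nat_floor_atTop.comp hs)
  have hratio : Tendsto (fun m : ℕ ↦ ((m : ℝ) + 3) / ((m : ℝ) + 1)) atTop (𝓝 1) := by
    have h1 : Tendsto (fun m : ℕ ↦ 1 + 2 * (1 / ((m : ℝ) + 1))) atTop (𝓝 (1 + 2 * 0)) :=
      (tendsto_one_div_add_atTop_nhds_zero_nat.const_mul 2).const_add 1
    rw [mul_zero, add_zero] at h1
    refine h1.congr fun m ↦ ?_
    field_simp
    ring
  have hup : Tendsto (fun m : ℕ ↦ (((m : ℝ) + 3) / ((m : ℝ) + 1)) ^ 2 *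
      (U (δ (m + 2)) * N (δ (m + 2)))) atTop (𝓝 t) := by
    simpa using (hratio.pow 2).mul (hlim.comp (tendsto_add_atTop_nat 2))
  have hlow : Tendsto (fun m : ℕ ↦ ((((m : ℝ) + 3) / ((m : ℝ) + 1)) ^ 2)⁻¹ *
      (U (δ m) * N (δ m))) atTop (𝓝 t) := by
    simpa using ((hratio.pow 2).inv₀ (by norm_num)).mul hlim
  refine tendsto_of_tendsto_of_tendsto_of_le_of_le' (hlow.comp hm) (hup.comp hm) ?_ ?_
  all_goals
    filter_upwards [self_mem_nhdsWithin, hs.eventually_ge_atTop 2] with x hx hx2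
    have hx0 : 0 < x := hx
    have hUx := hUpos x hx0
    obtain ⟨m, hm⟩ : ∃ m, ⌊√(c / U x)⌋₊ = m + 2 :=
      ⟨⌊√(c / U x)⌋₊ - 2, (Nat.sub_add_cancel (Nat.le_floor (by exact_mod_cast hx2))).symm⟩
    have h1 := Nat.floor_le (Real.sqrt_nonneg (c / U x))
    have h2 := Nat.lt_floor_add_one √(c / U x)
    rw [hm] at h1 h2
    push_cast at h1 h2
    have hsq : √(c / U x) ^ 2 = c / U x := Real.sq_sqrt (by positivity)
    have hm0 : (0 : ℝ) ≤ m := m.cast_nonneg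
    have h3 : ((m : ℝ) + 1) ^ 2 < c / U x := by nlinarith
    have h4 : c / U x < ((m : ℝ) + 3) ^ 2 := by
      rw [← hsq]
      exact pow_lt_pow_left₀ (by linarith) (Real.sqrt_nonneg _) two_ne_zero
    have h5 : U x < U (δ m) := by
      rw [lt_div_iff₀ hUx] at h3
      rw [hUδ, lt_div_iff₀ (by positivity)]
      linarith
    have h6 : U (δ (m + 2)) < U x := by
      rw [div_lt_iff₀ hUx] at h4
      rw [hUδ, div_lt_iff₀ (by positivity)]
      push_cast
      linarith
    have h7 := hN x _ hx0 (hU.reflect_lt h5).le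
    have h8 := hN _ x (hδ _) (hU.reflect_lt h6).le
    simp only [Function.comp_apply, hm, Nat.add_sub_cancel]
  · calc _ = U (δ (m + 2)) * N (δ m) := by
          rw [hUδ, hUδ]
          push_cast
          field_simp
          ring
      _ ≤ U x * N x := mul_le_mul h6.le h7 (hNnn _) hUx.le
  · calc U x * N x ≤ U (δ m) * N (δ (m + 2)) :=
          mul_le_mul h5.le h8 (hNnn _) (hUx.trans h5).le
      _ = _ := by
          rw [hUδ, hUδ]
          push_cast
          field_simp
          ring

lemma tendsto_of_tsum_sq_error {a : ℕ → ℝ} {t : ℝ}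
    (h : ∑' n, ENNReal.ofReal ((a n - t) ^ 2) ≠ ∞) : Tendsto a atTop (𝓝 t) := by
  have h1 := (ENNReal.tendsto_toReal ENNReal.zero_ne_top)
    |>.comp (ENNReal.tendsto_atTop_zero_of_tsum_ne_top h)
  have h2 : Tendsto (fun n ↦ √((a n - t) ^ 2)) atTop (𝓝 √0) := by
    refine (Real.continuous_sqrt.tendsto _).comp (h1.congr fun n ↦ ?_)
    simp [ENNReal.toReal_ofReal (sq_nonneg _)]
  simp_rw [Real.sqrt_sq_eq_abs, Real.sqrt_zero] at h2
  exact tendsto_iff_norm_sub_tendsto_zero.2 h2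

/-! ### Mean square error of U(δ) N(t, δ) -/

/-- The number of intervals in the greedy covering of the values of the path on a dyadic grid. -/
noncomputable def gridCount (X : ℝ≥0 → Ω → ℝ) (t : ℝ≥0) (δ : ℝ) (n : ℕ) (ω : Ω) : ℕ :=
  (greedy δ (fun k ↦ X ((k + 1 : ℕ) * (t / 2 ^ n)) ω - X ((k : ℕ) * (t / 2 ^ n)) ω) (2 ^ n)).2

namespace IsSubordinator

lemma measurable_gridCount (hX : IsSubordinator X P) (t : ℝ≥0) (δ : ℝ) (n : ℕ) :
    Measurable (gridCount X t δ n) :=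
  (measurable_greedy δ (fun k ↦ (hX.measurable ((k + 1 : ℕ) * (t / 2 ^ n))).sub
    (hX.measurable (k * (t / 2 ^ n)))) (2 ^ n)).snd

lemma ae_eventually_rangeCoverNumber_eq (hX : IsSubordinator X P) (t : ℝ≥0) :
    ∀ᵐ ω ∂P, ∀ δ : ℝ, 0 < δ →
      ∀ᶠ n in atTop, rangeCoverNumber X t δ ω = (gridCount X t δ n ω : ℕ∞) := by
  filter_upwards [hX.mono, hX.right_continuous] with ω hm hrc δ hδ
  have hS : ∀ n : ℕ, Monotone fun k : ℕ ↦ X (k * (t / 2 ^ n)) ω := fun n i j hij ↦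
    hm (mul_le_mul_left (Nat.cast_le.2 hij) _)
  have himg : ∀ n : ℕ, (fun s ↦ X s ω) '' dyadicGrid t n =
      (fun k : ℕ ↦ X (k * (t / 2 ^ n)) ω) '' Iic (2 ^ n) := fun n ↦ image_image _ _ _
  refine eventually_coverNumber_dyadicGrid hm hrc t hδ (fun n ↦ ?_) fun n ↦ ?_
  · rw [himg]
    exact coveredBy_greedy hδ.le (hS n) _
  · rw [himg]
    exact coverNumber_eq_greedy hδ.le (hS n) _

lemma lintegral_gridCount_le [IsProbabilityMeasure P] (hX : IsSubordinator X P)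
    {t h : ℝ≥0} {n : ℕ} (hh : t / 2 ^ n = h) (hfin : ∀ x, renewal X P h x < ∞) {δ : ℝ}
    (hδ : 0 ≤ δ) :
    ∫⁻ ω, ENNReal.ofReal ((h * (renewal X P h δ).toReal * gridCount X t δ n ω - t) ^ 2) ∂P ≤
      ENNReal.ofReal (4 * t * (h * (renewal X P h δ).toReal) +
        2 * (h * (renewal X P h δ).toReal) ^ 2) := by
  have ht : (h : ℝ) * ((2 ^ n : ℕ) : ℝ) = t := by
    rw [← hh]
    push_cast
    field_simp
  have hmono : Monotone fun k : ℕ ↦ (k : ℝ≥0) * h := fun i j hij ↦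
    mul_le_mul_left (Nat.cast_le.2 hij) _
  have hadd : ∀ k : ℕ, ((k + 1 : ℕ) : ℝ≥0) * h = k * h + h := fun k ↦ by push_cast; ring
  have key := lintegral_greedy_count_sub_sq_le (P := P) (μ := P.map (X h))
    (ξ := fun k ω ↦ X ((k + 1 : ℕ) * h) ω - X ((k : ℕ) * h) ω)
    (u := fun x ↦ (renewal X P h x).toReal) (δ := δ)
    (fun k ↦ (hX.measurable _).sub (hX.measurable _))
    (fun k ↦ by
      filter_upwards [hX.mono] with ω hω
      exact sub_nonneg.2 (hω (hmono k.le_succ)))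
    (hX.indep_increments.nat hmono)
    (fun k ↦ by
      simp_rw [hadd]
      exact (hX.stationary_increments (k * h) h).map_eq)
    (fun x y hxy ↦ ENNReal.toReal_mono (hfin y).ne (renewal_mono h hxy))
    (fun x ↦ ENNReal.toReal_nonneg)
    (fun x hx ↦ by simp [hX.renewal_of_neg h hx])
    (fun x hx ↦ hX.toReal_renewal_eq hfin hx) hδ (2 ^ n) h
  rw [ht] at key
  subst hh
  exact key

lemma ae_tendsto_mul_gridCount [IsProbabilityMeasure P] (hX : IsSubordinator X P)
    (hchar : HasDriftAndLevyMeasure X P d Pi)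
    (hne : Pi (Ioi 0) = ∞ ∨ (Pi (Ioi 0) < ∞ ∧ 0 < d)) {t : ℝ≥0} (ht : 0 < t) {δ : ℝ}
    (hδ : 0 < δ) :
    ∀ᵐ ω ∂P, Tendsto (fun n : ℕ ↦ ((t / 2 ^ n : ℝ≥0) : ℝ) *
        (renewal X P (t / 2 ^ n) δ).toReal * gridCount X t δ n ω) atTop
      (𝓝 ((potential X P δ).toReal * ((rangeCoverNumber X t δ ω).toNat : ℝ))) := by
  filter_upwards [hX.ae_eventually_rangeCoverNumber_eq t] with ω hω
  refine (hX.tendsto_mul_renewal hchar hne ht δ).mul (tendsto_const_nhds.congr' ?_)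
  filter_upwards [hω δ hδ] with n hn
  rw [hn, ENat.toNat_natCast]

/-- N is defined through uncountably many times; measurability comes from its being an almost sure
limit of grid counts. -/
lemma aemeasurable_sq_error [IsProbabilityMeasure P] (hX : IsSubordinator X P)
    (hchar : HasDriftAndLevyMeasure X P d Pi)
    (hne : Pi (Ioi 0) = ∞ ∨ (Pi (Ioi 0) < ∞ ∧ 0 < d)) {t : ℝ≥0} (ht : 0 < t) {δ : ℝ}
    (hδ : 0 < δ) :
    AEMeasurable (fun ω ↦ ENNReal.ofReal (((potential X P δ).toReal *
      ((rangeCoverNumber X t δ ω).toNat : ℝ) - t) ^ 2)) P := by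
  have h : AEMeasurable (fun ω ↦ (potential X P δ).toReal *
      ((rangeCoverNumber X t δ ω).toNat : ℝ)) P :=
    aemeasurable_of_tendsto_metrizable_ae atTop
      (fun n ↦ (((measurable_from_top (f := fun n : ℕ ↦ (n : ℝ))).comp
        (hX.measurable_gridCount t δ n)).const_mul _).aemeasurable)
      (hX.ae_tendsto_mul_gridCount hchar hne ht hδ)
  exact ((h.sub_const _).pow_const 2).ennreal_ofReal

/-- The mean square error of `U(δ) N(t, δ)` as an approximation of `t`. -/
theorem lintegral_sq_error_le [IsProbabilityMeasure P] (hX : IsSubordinator X P)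
    (hchar : HasDriftAndLevyMeasure X P d Pi)
    (hne : Pi (Ioi 0) = ∞ ∨ (Pi (Ioi 0) < ∞ ∧ 0 < d)) {t : ℝ≥0} (ht : 0 < t) {δ : ℝ}
    (hδ : 0 < δ) :
    ∫⁻ ω, ENNReal.ofReal (((potential X P δ).toReal *
        ((rangeCoverNumber X t δ ω).toNat : ℝ) - t) ^ 2) ∂P ≤
      ENNReal.ofReal (4 * t * (potential X P δ).toReal + 2 * (potential X P δ).toReal ^ 2) := by
  let F : ℕ → Ω → ℝ≥0∞ := fun n ω ↦ ENNReal.ofReal ((((t / 2 ^ n : ℝ≥0) : ℝ) *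
    (renewal X P (t / 2 ^ n) δ).toReal * gridCount X t δ n ω - t) ^ 2)
  have hF : ∀ n, AEMeasurable (F n) P := fun n ↦ by
    have h : AEMeasurable (fun ω ↦ (gridCount X t δ n ω : ℝ)) P :=
      ((measurable_from_top (f := fun n : ℕ ↦ (n : ℝ))).comp
        (hX.measurable_gridCount t δ n)).aemeasurable
    exact (((h.const_mul _).sub_const _).pow_const 2).ennreal_ofReal
  have hlim : Tendsto (fun n : ℕ ↦ ENNReal.ofReal
      (4 * t * (((t / 2 ^ n : ℝ≥0) : ℝ) * (renewal X P (t / 2 ^ n) δ).toReal) +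
        2 * (((t / 2 ^ n : ℝ≥0) : ℝ) * (renewal X P (t / 2 ^ n) δ).toReal) ^ 2)) atTop
      (𝓝 (ENNReal.ofReal (4 * t * (potential X P δ).toReal +
        2 * (potential X P δ).toReal ^ 2))) := by
    have h := hX.tendsto_mul_renewal hchar hne ht δ
    exact ENNReal.tendsto_ofReal ((h.const_mul _).add ((h.pow 2).const_mul 2))
  -- Fatou's lemma along the dyadic grids.
  calc _ = ∫⁻ ω, liminf (fun n ↦ F n ω) atTop ∂P := by
        refine lintegral_congr_ae ?_
        filter_upwards [hX.ae_tendsto_mul_gridCount hchar hne ht hδ] with ω hω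
        exact (ENNReal.tendsto_ofReal ((hω.sub_const _).pow 2)).liminf_eq.symm
    _ ≤ liminf (fun n ↦ ∫⁻ ω, F n ω ∂P) atTop := lintegral_liminf_le' hF
    _ ≤ _ := by
        rw [← hlim.liminf_eq]
        refine liminf_le_liminf (Eventually.of_forall fun n ↦ ?_)
        exact hX.lintegral_gridCount_le rfl
          (hX.renewal_lt_top hchar hne (by positivity)) hδ.le

/-- If U(δ) were 0, the mean square bound with t = 1 would read 1 ≤ 0. -/
lemma potential_pos [IsProbabilityMeasure P] (hX : IsSubordinator X P)
    (hchar : HasDriftAndLevyMeasure X P d Pi)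
    (hne : Pi (Ioi 0) = ∞ ∨ (Pi (Ioi 0) < ∞ ∧ 0 < d)) {δ : ℝ} (hδ : 0 < δ) :
    0 < (potential X P δ).toReal := by
  refine lt_of_le_of_ne ENNReal.toReal_nonneg fun h0 ↦ ?_
  have := hX.lintegral_sq_error_le hchar hne one_pos hδ
  rw [← h0] at this
  simp at this

end IsSubordinator

end SubordinatorRange

/-! ### Almost sure convergence -/

open SubordinatorRange in
theorem theorem1 {Ω : Type*} [MeasurableSpace Ω] (P : Measure Ω) [IsProbabilityMeasure P]
    (X : ℝ≥0 → Ω → ℝ) (hX : SubordinatorRange.IsSubordinator X P)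
    (d : ℝ) (Pi : Measure ℝ) (hchar : SubordinatorRange.HasDriftAndLevyMeasure X P d Pi)
    (hne : Pi (Ioi 0) = ∞ ∨ (Pi (Ioi 0) < ∞ ∧ 0 < d)) (t : ℝ≥0) (ht : 0 < t) :
    (∀ δ : ℝ, 0 < δ → SubordinatorRange.potential X P δ < ∞) ∧
    ∀ᵐ ω ∂P,
      (∀ δ : ℝ, 0 < δ → SubordinatorRange.rangeCoverNumber X t δ ω < ⊤) ∧
      Tendsto
        (fun δ : ℝ ↦ (SubordinatorRange.potential X P δ).toReal *
          ((SubordinatorRange.rangeCoverNumber X t δ ω).toNat : ℝ))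
        (𝓝[>] 0) (𝓝 (t : ℝ)) := by
  have hfin := hX.potential_lt_top hchar hne
  refine ⟨fun δ _ ↦ hfin δ, ?_⟩
  set U : ℝ → ℝ := fun δ ↦ (potential X P δ).toReal with hUdef
  have hUcont : Continuous U := continuous_iff_continuousAt.2 fun δ ↦
    (ENNReal.tendsto_toReal (hfin δ).ne).comp
      ((hX.continuous_potential hchar hne).tendsto δ)
  have hUmono : Monotone U := fun a b hab ↦ ENNReal.toReal_mono (hfin b).ne (potential_mono hab)
  have hUzero : U 0 = 0 := by simp [hUdef, hX.potential_zero hchar hne]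
  have hUpos : ∀ x, 0 < x → 0 < U x := fun x hx ↦ hX.potential_pos hchar hne hx
  have hc : 0 < U 1 := hUpos 1 one_pos
  have hex : ∀ n : ℕ, ∃ δ, 0 < δ ∧ U δ = U 1 / ((n : ℝ) + 1) ^ 2 := fun n ↦ by
    have hn : (1 : ℝ) ≤ ((n : ℝ) + 1) ^ 2 := by nlinarith [n.cast_nonneg (α := ℝ)]
    obtain ⟨δ, hδ, he⟩ := intermediate_value_Icc zero_le_one hUcont.continuousOn
      (show U 1 / ((n : ℝ) + 1) ^ 2 ∈ Icc (U 0) (U 1) from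
        ⟨by rw [hUzero]; positivity, div_le_self hc.le hn⟩)
    refine ⟨δ, lt_of_le_of_ne hδ.1 fun h0 ↦ ?_, he⟩
    rw [← h0, hUzero] at he
    exact (by positivity : U 1 / ((n : ℝ) + 1) ^ 2 ≠ 0) he.symm
  choose δ hδ hUδ using hex
  have hsum : ∑' n, ∫⁻ ω, ENNReal.ofReal ((U (δ n) *
      ((rangeCoverNumber X t (δ n) ω).toNat : ℝ) - t) ^ 2) ∂P ≠ ∞ := by
    have hs : Summable fun n : ℕ ↦ (4 * t + 2 * U 1) * U 1 * (1 / ((n : ℝ) + 1) ^ 2) := by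
      refine Summable.mul_left _ ?_
      simpa using (summable_nat_add_iff 1).2 (Real.summable_one_div_nat_pow.2 one_lt_two)
    refine ne_top_of_le_ne_top ?_ (ENNReal.tsum_le_tsum fun n ↦
      (hX.lintegral_sq_error_le hchar hne ht (hδ n)).trans (ENNReal.ofReal_le_ofReal
        (q := (4 * t + 2 * U 1) * U 1 * (1 / ((n : ℝ) + 1) ^ 2)) ?_))
    · rw [← ENNReal.ofReal_tsum_of_nonneg (fun n ↦ by positivity) hs]
      exact ENNReal.ofReal_ne_top
    · have h1 : U (δ n) ≤ U 1 := by
        rw [hUδ]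
        exact div_le_self hc.le (by nlinarith [n.cast_nonneg (α := ℝ)])
      have h2 : (4 * t + 2 * U 1) * U 1 * (1 / ((n : ℝ) + 1) ^ 2) =
          (4 * t + 2 * U 1) * U (δ n) := by
        rw [hUδ]
        ring
      rw [h2]
      change 4 * t * U (δ n) + 2 * U (δ n) ^ 2 ≤ _
      nlinarith [hUpos _ (hδ n)]
  rw [← lintegral_tsum fun n ↦ hX.aemeasurable_sq_error hchar hne ht (hδ n)] at hsum
  have hae := ae_lt_top' (AEMeasurable.tsum
    fun n ↦ hX.aemeasurable_sq_error hchar hne ht (hδ n)) hsum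
  filter_upwards [hae, hX.ae_eventually_rangeCoverNumber_eq t] with ω hω hcount
  -- Since `toNat` sends ⊤ to 0, finiteness is needed for N to stay monotone as a real function of
  -- δ.
  have htop : ∀ δ : ℝ, 0 < δ → rangeCoverNumber X t δ ω < ⊤ := fun δ hδ ↦ by
    obtain ⟨n, hn⟩ := (hcount δ hδ).exists
    rw [hn]
    exact ENat.natCast_lt_top _
  refine ⟨htop, tendsto_mul_of_tendsto_subseq (U := U)
    (N := fun δ ↦ ((rangeCoverNumber X t δ ω).toNat : ℝ)) hc hUmono hUpos ?_
    (fun x y hx hxy ↦ Nat.cast_le.2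
      (ENat.toNat_le_toNat (coverNumber_anti_length hxy) (htop x hx).ne))
    (fun x ↦ Nat.cast_nonneg _) hδ hUδ (tendsto_of_tsum_sq_error hω.ne)⟩
  have := hUcont.tendsto 0
  rw [hUzero] at this
  exact this.mono_left nhdsWithin_le_nhds
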